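/- **Model.** Let $\Pi$ be a set of $n$ processes and $L=\{S_1,\dots,S_m\}$ a bag of subsets of $\Pi$ such that every process is in at least one $S_i$. In the m&m system $\mathcal S_L$ the processes are asynchronous and may crash; every process can send messages to every process over reliable asynchronous links; and for every $i$ and every $p\in S_i$ there is an atomic shared register $R_i[p]$ that can be written by $p$ and read by the processes in $S_i$, and only by them. A step of a process is to send a message, to receive a message (or find that none has arrived), to read or write one shared register, to compute locally, or to return from an operation. An algorithm is given by a deterministic automaton for each process. In every execution each process that does not crash takes infinitely many steps, and each message sent to a process that does not crash and tries to receive infinitely often is received. Let $t_L$ be the largest integer $t\le n$ such that any two sets $P,P'\subseteq\Pi$ with $|P|=|P'|=n-t$ intersect or have members $p_1\in P$, $p_2\in P'$ that lie in a common $S_i$. **Atomic registers.** A register $\mathbf R$ with initial value $v_0$, writable by $w\in\Pi$ and readable by all processes, offers each process a read operation and offers $w$ write operations; each process calls operations one at a time. Operation $o$ *precedes* $o'$ if $o$ completes before $o'$ starts; $o$ and $o'$ are *concurrent* if neither precedes the other; a write $o$ *immediately precedes* a read $r$ if $o$ precedes $r$ and there is no write $o'$ such that $o$ precedes $o'$ and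 $o'$ precedes $r$. The values written are assumed to be distinct and different from $v_0$; let $v_k$ be the $k$-th value written. An algorithm *implements* such an atomic single-writer multi-reader (SWMR) register when at most $t$ processes may crash, if in every execution in which at most $t$ processes crash * every operation called by a process that does not crash completes; * if a read $r$ returns $v$, then some write of $v$ immediately precedes $r$ or is concurrent with $r$, or else no write precedes $r$ and $v=v_0$; * if reads $r,r'$ return $v_k,v_{k'}$ and $r$ precedes $r'$, then $k\le k'$. **Algorithm 1.** All shared registers initially hold $\langle 0,v_0\rangle$. To write its $i$-th value $x$, $w$ calls $\mathrm{Write}(\langle i,x\rangle)$. $\mathrm{Write}(\langle sn,x\rangle)$: send $\langle W,\langle sn,x\rangle\rangle$ to every process, wait for $\langle \text{ACK-W},sn\rangle$ from $n-t_L$ distinct processes, and return. Upon receipt of $\langle W,\langle sn,x\rangle\rangle$ from $q$, a process $p$ does the following for every $i$ with $p\in S_i$: it reads $R_i[p]$ and, if the sequence number found is less than $sn$, writes $\langle sn,x\rangle$ into $R_i[p]$; then it sends $\langle \text{ACK-W},sn\rangle$ to $q$. $\mathrm{Read}()$: increment the local counter $sn_r$, send $\langle R,sn_r\rangle$ to every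 process, wait for $\langle \text{ACK-R},sn_r,\cdot\rangle$ from $n-t_L$ distinct processes, let $\langle sn,x\rangle$ be the tuple with the largest sequence number received in them, call $\mathrm{Write}(\langle sn,x\rangle)$, and return $x$. Upon receipt of $\langle R,sn_r\rangle$ from $q$, a process $p$ reads all the $R_i[p']$ with $p,p'\in S_i$ and sends $\langle \text{ACK-R},sn_r,y\rangle$ to $q$, where $y$ is the tuple with the largest sequence number read. **Theorem.** 1. For every set of values, every initial value and every process $w$, Algorithm 1 implements in $\mathcal S_L$ an atomic SWMR register writable by $w$ and readable by all processes, when at most $t_L$ processes may crash. 2. Suppose $t_L<n-1$ and let $t>t_L$. For every set of at least two values and every initial value, there is a process $w$ such that no algorithm implements in $\mathcal S_L$ an atomic SWMR register writable by $w$ and readable by all processes, when up to $t$ processes may crash. -/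

import Mathlib

universe u v

namespace MM

/-! ## The resilience threshold of a bag

A bag `L = {S₁, …, S_m}` of sets of processes is a family `L : Fin m → Finset (Fin n)`. -/

/-- Any two sets of `n - t` processes intersect, or have members that lie in a common `S_i`. -/
def Overlapping {n m : ℕ} (L : Fin m → Finset (Fin n)) (t : ℕ) : Prop :=
  ∀ P P' : Finset (Fin n), P.card = n - t → P'.card = n - t →
    (P ∩ P').Nonempty ∨ ∃ i, ∃ p₁ ∈ P, ∃ p₂ ∈ P', p₁ ∈ L i ∧ p₂ ∈ L i

/-- `t_L`, the largest `t ≤ n` such that `Overlapping L t` (see `isGreatest_tL`). -/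
noncomputable def tL {n m : ℕ} (L : Fin m → Finset (Fin n)) : ℕ :=
  sSup {t | t ≤ n ∧ Overlapping L t}

theorem isGreatest_tL {n m : ℕ} (hn : 0 < n) (L : Fin m → Finset (Fin n)) :
    IsGreatest {t | t ≤ n ∧ Overlapping L t} (tL L) := by
  have hb : BddAbove {t | t ≤ n ∧ Overlapping L t} := ⟨n, fun t ht => ht.1⟩
  refine ⟨Nat.sSup_mem ⟨0, Nat.zero_le n, ?_⟩ hb, fun t ht => le_csSup hb ht⟩
  intro P P' hP hP'
  have h1 : P = Finset.univ := Finset.card_eq_iff_eq_univ P |>.1 (by simpa using hP)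
  have h2 : P' = Finset.univ := Finset.card_eq_iff_eq_univ P' |>.1 (by simpa using hP')
  exact Or.inl ⟨⟨0, hn⟩, by simp [h1, h2]⟩

/-! ## Algorithms for the system `S_L` -/

/-- The shared registers: for each `i` and each `p ∈ S_i`, a register `R_i[p]`. -/
abbrev Reg {n m : ℕ} (L : Fin m → Finset (Fin n)) : Type :=
  (i : Fin m) × {p : Fin n // p ∈ L i}

/-- The operations of the implemented register. -/
inductive Op (V : Type u) : Type u
  | write (x : V)
  | read

/-- The next step of process `p`, together with the local state that it leads to. The register
`R_i[q]` can be read by `p` only if `p ∈ S_i`, and `p` can write only registers `R_i[p]`. -/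
inductive Instr {n m : ℕ} (L : Fin m → Finset (Fin n)) (V : Type u) (State Msg RegVal : Type v)
    (p : Fin n) : Type (max u v)
  /-- send `a` to process `q` -/
  | send (q : Fin n) (a : Msg) (s : State)
  /-- try to receive a message: obtain a message with its sender, or nothing -/
  | recv (k : Option (Fin n × Msg) → State)
  /-- read the register `R_i[q]` -/
  | read (i : Fin m) (q : {q : Fin n // q ∈ L i}) (hp : p ∈ L i) (k : RegVal → State)
  /-- write `y` into the register `R_i[p]` -/
  | write (i : Fin m) (hp : p ∈ L i) (y : RegVal) (s : State)
  /-- complete the pending operation of `p`; `x` is the response if this is a read operation, and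
  it has no meaning if this is a write operation -/
  | ret (x : V) (s : State)
  /-- local computation -/
  | tau (s : State)

/-- An algorithm for the system `S_L` that offers `p` the operations of a register with values
in `V`. -/
structure Algorithm {n m : ℕ} (L : Fin m → Finset (Fin n)) (V : Type u) where
  /-- local states of the processes -/
  State : Type v
  /-- messages -/
  Msg : Type v
  /-- contents of the shared registers -/
  RegVal : Type v
  /-- starting states -/
  start : Fin n → State
  /-- starting contents of the shared registers -/
  regStart : Reg L → RegVal
  /-- effect of calling an operation on the local state of the caller -/
  invoke : Fin n → Op V → State → State
  /-- the next step of each process -/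
  act : (p : Fin n) → State → Instr L V State Msg RegVal p

/-! ## Executions -/

/-- A configuration. The bag `net` holds the triples (sender, receiver, message) that were sent
but not yet received; `pending` holds the processes that have called an operation that has not
yet returned. -/
structure Config {n m : ℕ} {L : Fin m → Finset (Fin n)} {V : Type u}
    (A : Algorithm.{u, v} L V) where
  state : Fin n → A.State
  net : Multiset (Fin n × Fin n × A.Msg)
  reg : Reg L → A.RegVal
  pending : Finset (Fin n)
  crashed : Finset (Fin n)

def Config.start {n m : ℕ} {L : Fin m → Finset (Fin n)} {V : Type u}
    (A : Algorithm.{u, v} L V) : Config A where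
  state := A.start
  net := 0
  reg := A.regStart
  pending := ∅
  crashed := ∅

/-- What can happen at one moment. -/
inductive Event (n : ℕ) (V : Type u) (Msg : Type v) : Type (max u v)
  /-- nothing happens -/
  | idle
  /-- `p` crashes -/
  | crash (p : Fin n)
  /-- `p` calls an operation of the implemented register -/
  | invoke (p : Fin n) (o : Op V)
  /-- `p` takes the next step of its algorithm; `d` is the message that is received, if any -/
  | step (p : Fin n) (d : Option (Fin n × Msg))

/-- `Step w a e b`: the event `e` can happen in the configuration `a` and leads to `b`, where
`w` is the writer of the implemented register. Processes that have crashed do nothing any more, a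
process calls an operation only if it has no pending one, and only `w` calls write operations. -/
def Step {n m : ℕ} {L : Fin m → Finset (Fin n)} {V : Type u} {A : Algorithm.{u, v} L V}
    (w : Fin n) (a : Config A) (e : Event n V A.Msg) (b : Config A) : Prop :=
  match e with
  | .idle => b = a
  | .crash p => b = { a with crashed := insert p a.crashed }
  | .invoke p o =>
      p ∉ a.crashed ∧ p ∉ a.pending ∧ (∀ x, o = Op.write x → p = w) ∧
      b = { a with
            state := Function.update a.state p (A.invoke p o (a.state p))
            pending := insert p a.pending }
  | .step p d =>
      p ∉ a.crashed ∧
      match A.act p (a.state p) with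
      | .send q c s => d = none ∧
          b = { a with
                state := Function.update a.state p s
                net := (p, q, c) ::ₘ a.net }
      | .recv k =>
          (d = none ∧ b = { a with state := Function.update a.state p (k none) }) ∨
          ∃ q c net', d = some (q, c) ∧ a.net = (q, p, c) ::ₘ net' ∧
            b = { a with
                  state := Function.update a.state p (k (some (q, c)))
                  net := net' }
      | .read i q _ k => d = none ∧
          b = { a with state := Function.update a.state p (k (a.reg ⟨i, q⟩)) }
      | .write i hp y s => d = none ∧
          b = { a with
                state := Function.update a.state p s
                reg := Function.update a.reg ⟨i, ⟨p, hp⟩⟩ y }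
      | .ret _ s => d = none ∧
          b = { a with
                state := Function.update a.state p s
                pending := a.pending.erase p }
      | .tau s => d = none ∧
          b = { a with state := Function.update a.state p s }

/-- An execution of `A` in which `w` is the writer of the implemented register; the indices are
the moments of time. -/
structure Execution {n m : ℕ} {L : Fin m → Finset (Fin n)} {V : Type u}
    (A : Algorithm.{u, v} L V) (w : Fin n) where
  cfg : ℕ → Config A
  ev : ℕ → Event n V A.Msg
  cfg_zero : cfg 0 = Config.start A
  cfg_succ : ∀ k, Step w (cfg k) (ev k) (cfg (k + 1))

namespace Execution

variable {n m : ℕ} {L : Fin m → Finset (Fin n)} {V : Type u} {A : Algorithm.{u, v} L V}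
  {w : Fin n}

/-- The processes that crash. -/
def faulty (E : Execution A w) : Set (Fin n) := {p | ∃ k, E.ev k = .crash p}

/-- At time `k`, process `p` takes a step that tries to receive a message. -/
def Polls (E : Execution A w) (p : Fin n) (k : ℕ) : Prop :=
  (∃ d, E.ev k = .step p d) ∧ ∃ f, A.act p ((E.cfg k).state p) = .recv f

/-- Processes that do not crash take infinitely many steps, and links are reliable: every message
sent to a process that does not crash, and does not stop trying to receive, is received. -/
structure Fair (E : Execution A w) : Prop where
  steps : ∀ p, p ∉ E.faulty → ∀ k, ∃ k' ≥ k, ∃ d, E.ev k' = .step p d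
  links : ∀ p, p ∉ E.faulty → (∀ k, ∃ k' ≥ k, E.Polls p k') →
    ∀ q c k, (q, p, c) ∈ (E.cfg k).net → ∃ k' ≥ k, E.ev k' = .step p (some (q, c))

/-- At time `e`, process `p` returns from an operation with response `x`. -/
def Returns (E : Execution A w) (p : Fin n) (x : V) (e : ℕ) : Prop :=
  (∃ d, E.ev e = .step p d) ∧ ∃ s, A.act p ((E.cfg e).state p) = .ret x s

/-! An operation is identified with the time at which it starts. -/

/-- The operation that starts at time `o` completes at time `e` with response `x`. -/
def Completes (E : Execution A w) (o e : ℕ) (x : V) : Prop :=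
  ∃ p f, E.ev o = .invoke p f ∧ o < e ∧ E.Returns p x e ∧
    ∀ k, o < k → k < e → ∀ y, ¬ E.Returns p y k

/-- `o` is an operation that writes `x`. -/
def IsWrite (E : Execution A w) (o : ℕ) (x : V) : Prop := ∃ p, E.ev o = .invoke p (.write x)

/-- `r` is a read operation that returns `x`. -/
def IsRead (E : Execution A w) (r : ℕ) (x : V) : Prop :=
  (∃ p, E.ev r = .invoke p .read) ∧ ∃ e, E.Completes r e x

/-- Operation `o` completes before operation `o'` starts. -/
def Precedes (E : Execution A w) (o o' : ℕ) : Prop := ∃ e x, E.Completes o e x ∧ e < o'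

def Concurrent (E : Execution A w) (o o' : ℕ) : Prop := ¬ E.Precedes o o' ∧ ¬ E.Precedes o' o

/-- The write operation `o` immediately precedes the read operation `r`. -/
def ImmediatelyPrecedes (E : Execution A w) (o r : ℕ) : Prop :=
  E.Precedes o r ∧ ¬ ∃ o' y, E.IsWrite o' y ∧ E.Precedes o o' ∧ E.Precedes o' r

/-- `x` is the value `v_k`: the starting value `v₀` if `k = 0`, and the value written by the
`k`-th write operation if `k ≥ 1`. -/
def IsValue (E : Execution A w) (v₀ : V) (k : ℕ) (x : V) : Prop :=
  (k = 0 ∧ x = v₀) ∨ ∃ o, E.IsWrite o x ∧ {o' | o' ≤ o ∧ ∃ y, E.IsWrite o' y}.ncard = k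

/-- The values written are distinct and different from the starting value `v₀`. -/
def DistinctWrites (E : Execution A w) (v₀ : V) : Prop :=
  (∀ o x, E.IsWrite o x → x ≠ v₀) ∧
  ∀ o o' x, E.IsWrite o x → E.IsWrite o' x → o = o'

/-- First property of an atomic register with starting value `v₀`. -/
def Property1 (E : Execution A w) (v₀ : V) : Prop :=
  ∀ r x, E.IsRead r x →
    (∃ o, E.IsWrite o x ∧ (E.ImmediatelyPrecedes o r ∨ E.Concurrent o r)) ∨
    ((∀ o y, E.IsWrite o y → ¬ E.Precedes o r) ∧ x = v₀)

/-- Second property of an atomic register with starting value `v₀`. -/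
def Property2 (E : Execution A w) (v₀ : V) : Prop :=
  ∀ r r' x x' k k', E.IsRead r x → E.IsRead r' x' → E.IsValue v₀ k x → E.IsValue v₀ k' x' →
    E.Precedes r r' → k ≤ k'

/-- Every operation called by a process that does not crash completes. -/
def Terminating (E : Execution A w) : Prop :=
  ∀ o p f, E.ev o = .invoke p f → p ∉ E.faulty → ∃ e x, E.Completes o e x

end Execution

/-- In the system `S_L`, if at most `t` processes crash, `A` implements an atomic SWMR register
with starting value `v₀` that is writable by `w` and readable by all processes. As usual in the
definition of atomicity by `Property1` and `Property2`, the values that `w` writes are distinct and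
different from `v₀`. -/
def Implements {n m : ℕ} {L : Fin m → Finset (Fin n)} {V : Type u} (A : Algorithm.{u, v} L V)
    (w : Fin n) (v₀ : V) (t : ℕ) : Prop :=
  ∀ E : Execution A w, E.Fair → E.faulty.ncard ≤ t → E.DistinctWrites v₀ →
    E.Terminating ∧ E.Property1 v₀ ∧ E.Property2 v₀

/-! ## The read/write algorithm

The tuple `⟨i, x⟩` stands for the `i`-th value written, `x`; the writer makes it by counting its
write operations. The starting value is `⟨0, v₀⟩`.

* `Write(⟨sn, x⟩)`: send `⟨W, ⟨sn, x⟩⟩` to every process; wait for `⟨ACK-W, sn⟩` from `n - t_L`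
  distinct processes; return.
* Upon `⟨W, ⟨sn, x⟩⟩` from `src`: for every `i` with `p ∈ S_i`, read `R_i[p]`, and overwrite it by
  `⟨sn, x⟩` if its sequence number is less than `sn`; then send `⟨ACK-W, sn⟩` to `src`.
* `Read()`: increment `snr`; send `⟨R, snr⟩` to every process; wait for `⟨ACK-R, snr, -⟩` from
  `n - t_L` distinct processes; let `⟨sn, x⟩` be the largest tuple received; call
  `Write(⟨sn, x⟩)`; return `x`.
* Upon `⟨R, snr⟩` from `src`: read every `R_i[q]` with `p, q ∈ S_i`; send `⟨ACK-R, snr, tup⟩` to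
  `src`, where `tup` is the largest tuple read. -/

namespace RW

inductive Msg (V : Type u) : Type u
  /-- `⟨W, ⟨sn, x⟩⟩` -/
  | W (tup : ℕ × V)
  /-- `⟨ACK-W, sn⟩` -/
  | ackW (sn : ℕ)
  /-- `⟨R, snr⟩` -/
  | R (snr : ℕ)
  /-- `⟨ACK-R, snr, ⟨sn, x⟩⟩` -/
  | ackR (snr : ℕ) (tup : ℕ × V)

/-- Where a process is in the procedures `Write` and `Read`. -/
inductive Client (n : ℕ) (V : Type u) : Type u
  | none
  /-- in `Write(tup)`: `todo` are the processes to which `⟨W, tup⟩` is still to be sent, and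
  `acks` those whose acknowledgment was received -/
  | writing (todo : List (Fin n)) (acks : Finset (Fin n)) (tup : ℕ × V)
  /-- in `Read()`, before it calls `Write`: `todo` are the processes to which `⟨R, snr⟩` is still
  to be sent, `acks` those whose acknowledgment was received, and `best` the largest tuple
  received -/
  | reading (todo : List (Fin n)) (acks : Finset (Fin n)) (best : ℕ × V)

/-- Where a process is in the two message handlers, called upon a message from `src`. -/
inductive Server (n m : ℕ) (V : Type u) : Type u
  | none
  /-- handler of `⟨W, tup⟩`: the indices in `todo` are still to be treated -/
  | wloop (todo : List (Fin m)) (tup : ℕ × V) (src : Fin n)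
  /-- handler of `⟨W, tup⟩`, about to write `tup` into `R_i[p]` -/
  | wput (i : Fin m) (todo : List (Fin m)) (tup : ℕ × V) (src : Fin n)
  /-- handler of `⟨R, snr⟩`: the registers `R_i[q]` with `(i, q)` in `todo` are still to be read,
  and `best` is the largest tuple read -/
  | rloop (todo : List (Fin m × Fin n)) (best : ℕ × V) (snr : ℕ) (src : Fin n)

/-- The local state; `sn` counts the calls of write, and `snr` the calls of read. -/
structure State (n m : ℕ) (V : Type u) : Type u where
  sn : ℕ
  snr : ℕ
  client : Client n V
  server : Server n m V

/-- The tuple with the larger sequence number. -/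
def maxTup {V : Type u} (a b : ℕ × V) : ℕ × V := if a.1 < b.1 then b else a

/-- The effect of what was received. -/
def receive {n m : ℕ} {V : Type u} (v₀ : V) (s : State n m V) :
    Option (Fin n × Msg V) → State n m V
  | Option.none => s
  | some (src, .W tup) => { s with server := .wloop (List.finRange m) tup src }
  | some (src, .R snr) =>
      { s with server := .rloop (List.finRange m ×ˢ List.finRange n) (0, v₀) snr src }
  | some (src, .ackW sn) =>
      match s.client with
      | .writing todo acks tup =>
          if sn = tup.1 then { s with client := .writing todo (insert src acks) tup } else s
      | _ => s
  | some (src, .ackR snr tup) =>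
      match s.client with
      | .reading todo acks best =>
          if snr = s.snr then
            { s with client := .reading todo (insert src acks) (maxTup best tup) }
          else s
      | _ => s

/-- Calls of the two operations: the writer increments `sn` and calls `Write(⟨sn, x⟩)`; a reader
increments `snr` and calls `Read()`. -/
def invoke {n m : ℕ} {V : Type u} (v₀ : V) (s : State n m V) : Op V → State n m V
  | .write x =>
      { s with sn := s.sn + 1, client := .writing (List.finRange n) ∅ (s.sn + 1, x) }
  | .read =>
      { s with snr := s.snr + 1, client := .reading (List.finRange n) ∅ (0, v₀) }

/-- The next step of process `p`: handlers are run to their end before anything else. -/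
noncomputable def act {n m : ℕ} (L : Fin m → Finset (Fin n)) {V : Type u} (v₀ : V) (p : Fin n)
    (s : State n m V) : Instr L V (State n m V) (Msg V) (ℕ × V) p :=
  match s.server with
  | .wloop (i :: todo) tup src =>
      if h : p ∈ L i then
        .read i ⟨p, h⟩ h fun y =>
          { s with server := if y.1 < tup.1 then .wput i todo tup src else .wloop todo tup src }
      else .tau { s with server := .wloop todo tup src }
  | .wput i todo tup src =>
      if h : p ∈ L i then .write i h tup { s with server := .wloop todo tup src }
      else .tau { s with server := .wloop todo tup src }
  | .wloop [] tup src => .send src (.ackW tup.1) { s with server := .none }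
  | .rloop ((i, q) :: todo) best snr src =>
      if h : p ∈ L i ∧ q ∈ L i then
        .read i ⟨q, h.2⟩ h.1 fun y => { s with server := .rloop todo (maxTup best y) snr src }
      else .tau { s with server := .rloop todo best snr src }
  | .rloop [] best snr src => .send src (.ackR snr best) { s with server := .none }
  | .none =>
    match s.client with
    | .none => .recv (receive v₀ s)
    | .writing (q :: todo) acks tup =>
        .send q (.W tup) { s with client := .writing todo acks tup }
    | .writing [] acks tup =>
        if n - tL L ≤ acks.card then .ret tup.2 { s with client := .none }
        else .recv (receive v₀ s)
    | .reading (q :: todo) acks best =>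
        .send q (.R s.snr) { s with client := .reading todo acks best }
    | .reading [] acks best =>
        if n - tL L ≤ acks.card then
          .tau { s with client := .writing (List.finRange n) ∅ best }
        else .recv (receive v₀ s)

end RW

/-- The read/write algorithm for the bag `L`, with starting value `v₀`. -/
noncomputable def rwAlgorithm {n m : ℕ} (L : Fin m → Finset (Fin n)) {V : Type u} (v₀ : V) :
    Algorithm.{u, u} L V where
  State := RW.State n m V
  Msg := RW.Msg V
  RegVal := ℕ × V
  start := fun _ => ⟨0, 0, .none, .none⟩
  regStart := fun _ => (0, v₀)
  invoke := fun _ o s => RW.invoke v₀ s o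
  act := RW.act L v₀

end MM

/-! Possibility. Call any `n - t_L` processes a quorum. When `Write(⟨k, x⟩)` returns, a quorum has
acknowledged, and all registers owned by its members hold sequence numbers at least `k`; they keep
doing so, because registers only grow (`AckInv`). A read that starts later takes the maximum over
the scans of a second quorum, all of them made after the read started (`ReadInv`). By the definition
of `t_L`, the two quorums have a common member or members in a common `S_i`; either way a member of
the second scans a register of a member of the first, so the tuple chosen is at least `k`
(`le_of_quorums`). A read writes its tuple back before it returns, so the same bound relates two
successive reads. Hence a read chooses a number that is at least everything quorum-stored when it
starts, and leaves that number quorum-stored (`read_spec`). Since sequence numbers count the writes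
of `w`, both properties of atomicity are arithmetic on these numbers.

Termination holds because a correct process cannot go on forever without trying to receive
(`Fair.polls`), so requests to correct processes and their replies all arrive, and at least `n -
t_L` processes are correct (`Fair.quorum_replies`).

Impossibility. By maximality of `t_L` there are nonempty sets `P`, `P'` of `n - t_L - 1` processes
that are disjoint and share no `S_i`. If everyone outside `P` crashes, a writer in `P` must still
complete a write of `v₁ ≠ v₀`; if everyone outside `P'` crashes, a reader in `P'` must still return
`v₀` (`exists_solo_run`). No process of `P'` can read a register owned by `P`, and messages between
the two sets can be delayed. So the second run can be played after the first with both sets alive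
(`Step.merge`), and then continued fairly (`exists_fair_run`). In that execution a read misses a
write that precedes it. -/

namespace MM

/-! ### The transition relation of the read/write algorithm -/

namespace RW

/-- A configuration of the read/write algorithm, without the set of crashed processes. -/
structure Cfg {n m : ℕ} (L : Fin m → Finset (Fin n)) (V : Type u) : Type u where
  state : Fin n → State n m V
  net : Multiset (Fin n × Fin n × Msg V)
  reg : Reg L → ℕ × V
  pending : Finset (Fin n)

variable {n m : ℕ} {L : Fin m → Finset (Fin n)} {V : Type u}

/-- Process in state `s` has nothing to do but to wait for messages. -/
def Polling (L : Fin m → Finset (Fin n)) (s : State n m V) : Prop :=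
  s.server = .none ∧
    (s.client = .none ∨
      (∃ acks tup, s.client = .writing [] acks tup ∧ acks.card < n - tL L) ∨
      ∃ acks best, s.client = .reading [] acks best ∧ acks.card < n - tL L)

def Cfg.setState (a : Cfg L V) (p : Fin n) (s : State n m V) : Cfg L V :=
  { a with state := Function.update a.state p s }

def Cfg.setServer (a : Cfg L V) (p : Fin n) (c : Server n m V) : Cfg L V :=
  { a with state := Function.update a.state p { a.state p with server := c } }

def Cfg.setClient (a : Cfg L V) (p : Fin n) (c : Client n V) : Cfg L V :=
  { a with state := Function.update a.state p { a.state p with client := c } }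

/-- The transitions of the read/write algorithm. -/
inductive Trans (L : Fin m → Finset (Fin n)) (v₀ : V) (w : Fin n) :
    Cfg L V → Event n V (Msg V) → Cfg L V → Prop
  | idle (a) : Trans L v₀ w a .idle a
  | crash (a p) : Trans L v₀ w a (.crash p) a
  | invokeWrite (a : Cfg L V) (p x) (hp : p ∉ a.pending) (hw : p = w) :
      Trans L v₀ w a (.invoke p (.write x))
        { a with
          state := Function.update a.state p
            { a.state p with
              sn := (a.state p).sn + 1
              client := .writing (List.finRange n) ∅ ((a.state p).sn + 1, x) }
          pending := insert p a.pending }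
  | invokeRead (a : Cfg L V) (p) (hp : p ∉ a.pending) :
      Trans L v₀ w a (.invoke p .read)
        { a with
          state := Function.update a.state p
            { a.state p with
              snr := (a.state p).snr + 1
              client := .reading (List.finRange n) ∅ (0, v₀) }
          pending := insert p a.pending }
  | testLT (a : Cfg L V) (p i todo tup src) (h : p ∈ L i)
      (hs : (a.state p).server = .wloop (i :: todo) tup src) (hlt : (a.reg ⟨i, p, h⟩).1 < tup.1) :
      Trans L v₀ w a (.step p none) (a.setServer p (.wput i todo tup src))
  | testGE (a : Cfg L V) (p i todo tup src) (h : p ∈ L i)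
      (hs : (a.state p).server = .wloop (i :: todo) tup src) (hge : tup.1 ≤ (a.reg ⟨i, p, h⟩).1) :
      Trans L v₀ w a (.step p none) (a.setServer p (.wloop todo tup src))
  | skipTest (a : Cfg L V) (p i todo tup src) (h : p ∉ L i)
      (hs : (a.state p).server = .wloop (i :: todo) tup src) :
      Trans L v₀ w a (.step p none) (a.setServer p (.wloop todo tup src))
  | put (a : Cfg L V) (p i todo tup src) (h : p ∈ L i)
      (hs : (a.state p).server = .wput i todo tup src) :
      Trans L v₀ w a (.step p none)
        { a.setServer p (.wloop todo tup src) with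
          reg := Function.update a.reg ⟨i, p, h⟩ tup }
  | skipPut (a : Cfg L V) (p i todo tup src) (h : p ∉ L i)
      (hs : (a.state p).server = .wput i todo tup src) :
      Trans L v₀ w a (.step p none) (a.setServer p (.wloop todo tup src))
  | sendAckW (a : Cfg L V) (p tup src) (hs : (a.state p).server = .wloop [] tup src) :
      Trans L v₀ w a (.step p none)
        { a.setServer p .none with net := (p, src, .ackW tup.1) ::ₘ a.net }
  | readReg (a : Cfg L V) (p i q todo best c src) (hp : p ∈ L i) (hq : q ∈ L i)
      (hs : (a.state p).server = .rloop ((i, q) :: todo) best c src) :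
      Trans L v₀ w a (.step p none)
        (a.setServer p (.rloop todo (maxTup best (a.reg ⟨i, q, hq⟩)) c src))
  | skipReg (a : Cfg L V) (p i q todo best c src) (h : ¬ (p ∈ L i ∧ q ∈ L i))
      (hs : (a.state p).server = .rloop ((i, q) :: todo) best c src) :
      Trans L v₀ w a (.step p none) (a.setServer p (.rloop todo best c src))
  | sendAckR (a : Cfg L V) (p best c src) (hs : (a.state p).server = .rloop [] best c src) :
      Trans L v₀ w a (.step p none)
        { a.setServer p .none with net := (p, src, .ackR c best) ::ₘ a.net }
  | recvNone (a : Cfg L V) (p) (hp : Polling L (a.state p)) : Trans L v₀ w a (.step p none) a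
  | recvW (a : Cfg L V) (p src tup net) (hp : Polling L (a.state p))
      (hn : a.net = (src, p, .W tup) ::ₘ net) :
      Trans L v₀ w a (.step p (some (src, .W tup)))
        { a.setServer p (.wloop (List.finRange m) tup src) with net := net }
  | recvR (a : Cfg L V) (p src c net) (hp : Polling L (a.state p))
      (hn : a.net = (src, p, .R c) ::ₘ net) :
      Trans L v₀ w a (.step p (some (src, .R c)))
        { a.setServer p (.rloop (List.finRange m ×ˢ List.finRange n) (0, v₀) c src) with
          net := net }
  | recvAckW (a : Cfg L V) (p src acks tup net) (hp : Polling L (a.state p))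
      (hc : (a.state p).client = .writing [] acks tup)
      (hn : a.net = (src, p, .ackW tup.1) ::ₘ net) :
      Trans L v₀ w a (.step p (some (src, .ackW tup.1)))
        { a.setClient p (.writing [] (insert src acks) tup) with net := net }
  | recvAckR (a : Cfg L V) (p src acks best tup net) (hp : Polling L (a.state p))
      (hc : (a.state p).client = .reading [] acks best)
      (hn : a.net = (src, p, .ackR (a.state p).snr tup) ::ₘ net) :
      Trans L v₀ w a (.step p (some (src, .ackR (a.state p).snr tup)))
        { a.setClient p (.reading [] (insert src acks) (maxTup best tup)) with net := net }
  | dropAckW (a : Cfg L V) (p src k net) (hp : Polling L (a.state p))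
      (hc : ∀ todo acks tup, (a.state p).client = .writing todo acks tup → k ≠ tup.1)
      (hn : a.net = (src, p, .ackW k) ::ₘ net) :
      Trans L v₀ w a (.step p (some (src, .ackW k))) { a with net := net }
  | dropAckR (a : Cfg L V) (p src k tup net) (hp : Polling L (a.state p))
      (hc : ∀ todo acks best, (a.state p).client = .reading todo acks best → k ≠ (a.state p).snr)
      (hn : a.net = (src, p, .ackR k tup) ::ₘ net) :
      Trans L v₀ w a (.step p (some (src, .ackR k tup))) { a with net := net }
  | sendW (a : Cfg L V) (p q todo acks tup) (hs : (a.state p).server = .none)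
      (hc : (a.state p).client = .writing (q :: todo) acks tup) :
      Trans L v₀ w a (.step p none)
        { a.setClient p (.writing todo acks tup) with net := (p, q, .W tup) ::ₘ a.net }
  | ret (a : Cfg L V) (p acks tup) (hs : (a.state p).server = .none)
      (hc : (a.state p).client = .writing [] acks tup) (hcard : n - tL L ≤ acks.card) :
      Trans L v₀ w a (.step p none)
        { a.setClient p .none with pending := a.pending.erase p }
  | sendR (a : Cfg L V) (p q todo acks best) (hs : (a.state p).server = .none)
      (hc : (a.state p).client = .reading (q :: todo) acks best) :
      Trans L v₀ w a (.step p none)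
        { a.setClient p (.reading todo acks best) with
          net := (p, q, .R (a.state p).snr) ::ₘ a.net }
  | switch (a : Cfg L V) (p acks best) (hs : (a.state p).server = .none)
      (hc : (a.state p).client = .reading [] acks best) (hcard : n - tL L ≤ acks.card) :
      Trans L v₀ w a (.step p none) (a.setClient p (.writing (List.finRange n) ∅ best))

/-- Process in state `s` returns `x` from its operation in its next step. -/
def Returning (L : Fin m → Finset (Fin n)) (s : State n m V) (x : V) : Prop :=
  s.server = .none ∧ ∃ acks tup, s.client = .writing [] acks tup ∧ n - tL L ≤ acks.card ∧ x = tup.2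

theorem act_eq_recv {v₀ : V} {p : Fin n} {s : State n m V} {f} (h : act L v₀ p s = .recv f) :
    Polling L s ∧ f = receive v₀ s := by
  obtain ⟨sn, snr, client, server⟩ := s
  unfold act at h
  rcases server with _ | ⟨_ | ⟨i, todo⟩, tup, src⟩ | _ | ⟨_ | ⟨⟨i, q⟩, todo⟩, tup, src⟩ <;>
    rcases client with _ | ⟨_ | ⟨i, todo⟩, acks, tup⟩ | ⟨_ | ⟨i, todo⟩, acks, tup⟩ <;>
    dsimp only at h <;> (try split_ifs at h) <;> (try cases h) <;>
    simp_all [Polling] <;> omega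

theorem act_of_polling {v₀ : V} {p : Fin n} {s : State n m V} (h : Polling L s) :
    act L v₀ p s = .recv (receive v₀ s) := by
  obtain ⟨sn, snr, client, server⟩ := s
  obtain ⟨rfl, rfl | ⟨acks, tup, rfl, hc⟩ | ⟨acks, tup, rfl, hc⟩⟩ := h <;> simp [act] <;> omega

theorem act_eq_ret {v₀ : V} {p : Fin n} {s : State n m V} {x s'}
    (h : act L v₀ p s = .ret x s') : Returning L s x := by
  obtain ⟨sn, snr, client, server⟩ := s
  unfold act at h
  rcases server with _ | ⟨_ | ⟨i, todo⟩, tup, src⟩ | _ | ⟨_ | ⟨⟨i, q⟩, todo⟩, tup, src⟩ <;>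
    rcases client with _ | ⟨_ | ⟨i, todo⟩, acks, tup⟩ | ⟨_ | ⟨i, todo⟩, acks, tup⟩ <;>
    dsimp only at h <;> (try split_ifs at h) <;> (try cases h) <;>
    simp_all [Returning]; exact ⟨_, rfl⟩

theorem act_of_returning {v₀ : V} {p : Fin n} {s : State n m V} {x} (h : Returning L s x) :
    ∃ s', act L v₀ p s = .ret x s' := by
  obtain ⟨sn, snr, client, server⟩ := s
  obtain ⟨rfl, acks, tup, rfl, hc, rfl⟩ := h
  exact ⟨_, by simp only [act]; rw [if_pos hc]⟩

end RW

def Config.view {n m : ℕ} {L : Fin m → Finset (Fin n)} {V : Type u} {v₀ : V}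
    (a : Config (rwAlgorithm L v₀)) : RW.Cfg L V :=
  ⟨a.state, a.net, a.reg, a.pending⟩

namespace RW

variable {n m : ℕ} {L : Fin m → Finset (Fin n)} {V : Type u}

/-- Performs once and for all the rewriting of the instruction inside the match of `Step`, so that a
user has only to name the instruction. -/
theorem step_act {v₀ : V} {w p : Fin n} {a b : Config (rwAlgorithm L v₀)}
    {d : Option (Fin n × Msg V)} (h : Step w a (.step p d) b) {I}
    (hI : act L v₀ p (a.view.state p) = I) :
    match I with
      | .send q c s => d = none ∧
          b.view = { a.view.setState p s with net := (p, q, c) ::ₘ a.net }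
      | .recv k =>
          (d = none ∧ b.view = a.view.setState p (k none)) ∨
          ∃ q c net', d = some (q, c) ∧ a.net = (q, p, c) ::ₘ net' ∧
            b.view = { a.view.setState p (k (some (q, c))) with net := net' }
      | .read i q _ k => d = none ∧ b.view = a.view.setState p (k (a.view.reg ⟨i, q⟩))
      | .write i hp y s => d = none ∧
          b.view = { a.view.setState p s with
                reg := Function.update a.view.reg ⟨i, ⟨p, hp⟩⟩ y }
      | .ret _ s => d = none ∧
          b.view = { a.view.setState p s with pending := a.pending.erase p }
      | .tau s => d = none ∧ b.view = a.view.setState p s := by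
  obtain ⟨-, h⟩ := h
  have hI' : (rwAlgorithm L v₀).act p (a.state p) = I := hI
  rw [hI'] at h
  rcases I with _ | _ | _ | _ | _ | _
  · obtain ⟨h1, rfl⟩ := h
    exact ⟨h1, rfl⟩
  · rcases h with ⟨h1, rfl⟩ | ⟨q, c, net', h1, h2, rfl⟩
    · exact Or.inl ⟨h1, rfl⟩
    · exact Or.inr ⟨q, c, net', h1, h2, rfl⟩
  all_goals
    obtain ⟨h1, rfl⟩ := h
    exact ⟨h1, rfl⟩

/-- Only this direction is needed: `Trans` forgets who has crashed and thus over-approximates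
`Step`, which is harmless for invariants. These are then proved by cases on `Trans` instead of on
nested matches. -/
theorem trans_of_step {v₀ : V} {w : Fin n} {a b : Config (rwAlgorithm L v₀)}
    {e : Event n V (Msg V)} (h : Step w a e b) : Trans L v₀ w a.view e b.view := by
  rcases e with _ | p | ⟨p, o⟩ | ⟨p, d⟩
  · obtain rfl := h
    exact .idle _
  · obtain rfl := h
    exact .crash _ _
  · obtain ⟨h1, h2, h3, rfl⟩ := h
    rcases o with x | _
    · exact .invokeWrite a.view p x h2 (h3 x rfl)
    · exact .invokeRead a.view p h2
  · rcases hs : (a.view.state p).server with _ | ⟨_ | ⟨i, todo⟩, tup, src⟩ | ⟨i, todo, tup, src⟩ |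
      ⟨_ | ⟨⟨i, q⟩, todo⟩, best, c, src⟩
    · by_cases hpol : Polling L (a.view.state p)
      · rcases step_act h (act_of_polling hpol) with ⟨rfl, hb⟩ | ⟨q, c, net', rfl, hn, hb⟩
        · have : b.view = a.view := by
            rw [hb]
            exact congrArg (fun f => (⟨f, a.net, a.reg, a.pending⟩ : Cfg L V))
              (Function.update_eq_self p a.state)
          rw [this]
          exact .recvNone _ _ hpol
        · rw [hb]
          rcases c with tup | k | k | ⟨k, tup⟩
          · exact .recvW a.view p q tup net' hpol hn
          · by_cases hk : ∃ acks tup, (a.view.state p).client = .writing [] acks tup ∧ k = tup.1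
            · obtain ⟨acks, tup, hc, rfl⟩ := hk
              have := Trans.recvAckW (v₀ := v₀) (w := w) a.view p q acks tup net' hpol hc hn
              have e : receive v₀ (a.view.state p) (some (q, .ackW tup.1)) =
                  { a.view.state p with client := .writing [] (insert q acks) tup } := by
                simp only [receive, hc, if_true]
              change Trans L v₀ w a.view _ { a.view.setState p (receive v₀ (a.view.state p) _) with
                net := net' }
              rw [e]
              exact this
            · have hd : ∀ todo acks tup, (a.view.state p).client = .writing todo acks tup →
                  k ≠ tup.1 := by
                rintro todo acks tup hc rfl
                obtain ⟨-, h1 | ⟨acks', tup', h1, -⟩ | ⟨acks', tup', h1, -⟩⟩ := hpol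
                · simp [hc] at h1
                · exact hk ⟨acks', tup', h1, by rw [hc] at h1; cases h1; rfl⟩
                · simp [hc] at h1
              have e : receive v₀ (a.view.state p) (some (q, .ackW k)) = a.view.state p := by
                rcases hc : (a.view.state p).client with _ | ⟨todo, acks, tup⟩ | _ <;>
                  simp only [receive, hc]
                exact if_neg (hd _ _ _ hc)
              change Trans L v₀ w a.view _ { a.view.setState p (receive v₀ (a.view.state p) _) with
                net := net' }
              rw [e, Cfg.setState, Function.update_eq_self]
              exact .dropAckW a.view p q k net' hpol hd hn
          · exact .recvR a.view p q k net' hpol hn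
          · by_cases hk : ∃ acks best, (a.view.state p).client = .reading [] acks best ∧
                k = (a.view.state p).snr
            · obtain ⟨acks, best, hc, rfl⟩ := hk
              have := Trans.recvAckR (v₀ := v₀) (w := w) a.view p q acks best tup net' hpol hc hn
              have e : receive v₀ (a.view.state p) (some (q, .ackR (a.view.state p).snr tup)) =
                  { a.view.state p with
                    client := .reading [] (insert q acks) (maxTup best tup) } := by
                simp only [receive, hc, if_true]
              change Trans L v₀ w a.view _ { a.view.setState p (receive v₀ (a.view.state p) _) with
                net := net' }
              rw [e]
              exact this
            · have hd : ∀ todo acks best, (a.view.state p).client = .reading todo acks best →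
                  k ≠ (a.view.state p).snr := by
                rintro todo acks best hc rfl
                obtain ⟨-, h1 | ⟨acks', tup', h1, -⟩ | ⟨acks', tup', h1, -⟩⟩ := hpol
                · simp [hc] at h1
                · simp [hc] at h1
                · exact hk ⟨acks', tup', h1, rfl⟩
              have e : receive v₀ (a.view.state p) (some (q, .ackR k tup)) = a.view.state p := by
                rcases hc : (a.view.state p).client with _ | _ | ⟨todo, acks, best⟩ <;>
                  simp only [receive, hc]
                exact if_neg (hd _ _ _ hc)
              change Trans L v₀ w a.view _ { a.view.setState p (receive v₀ (a.view.state p) _) with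
                net := net' }
              rw [e, Cfg.setState, Function.update_eq_self]
              exact .dropAckR a.view p q k tup net' hpol hd hn
      · rcases hc : (a.view.state p).client with _ | ⟨_ | ⟨q, todo⟩, acks, tup⟩ |
          ⟨_ | ⟨q, todo⟩, acks, best⟩
        · exact absurd ⟨hs, Or.inl hc⟩ hpol
        · have hcard : n - tL L ≤ acks.card := by
            by_contra hlt
            exact hpol ⟨hs, Or.inr (Or.inl ⟨_, _, hc, not_le.1 hlt⟩)⟩
          obtain ⟨rfl, hb⟩ := step_act h
              (I := .ret tup.2 { a.view.state p with client := .none })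
              (by simp only [act, hs, hc]; rw [if_pos hcard])
          rw [hb]
          exact .ret a.view p acks tup hs hc hcard
        · obtain ⟨rfl, hb⟩ := step_act h
              (I := .send q (.W tup) { a.view.state p with client := .writing todo acks tup })
              (by simp only [act, hs, hc])
          rw [hb]
          exact .sendW a.view p q todo acks tup hs hc
        · have hcard : n - tL L ≤ acks.card := by
            by_contra hlt
            exact hpol ⟨hs, Or.inr (Or.inr ⟨_, _, hc, not_le.1 hlt⟩)⟩
          obtain ⟨rfl, hb⟩ := step_act h
              (I := .tau { a.view.state p with client := .writing (List.finRange n) ∅ best })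
              (by simp only [act, hs, hc]; rw [if_pos hcard])
          rw [hb]
          exact .switch a.view p acks best hs hc hcard
        · obtain ⟨rfl, hb⟩ := step_act h
              (I := .send q (.R (a.view.state p).snr) { a.view.state p with client := .reading todo acks best })
              (by simp only [act, hs, hc])
          rw [hb]
          exact .sendR a.view p q todo acks best hs hc
    · obtain ⟨rfl, hb⟩ := step_act h
              (I := .send src (.ackW tup.1) { a.view.state p with server := .none })
              (by simp only [act, hs])
      rw [hb]
      exact .sendAckW a.view p tup src hs
    · by_cases hp : p ∈ L i
      · obtain ⟨rfl, hb⟩ := step_act h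
              (I := .read i ⟨p, hp⟩ hp fun y => { a.view.state p with
                server := if y.1 < tup.1 then .wput i todo tup src else .wloop todo tup src })
              (by simp only [act, hs]; rw [dif_pos hp])
        rw [hb]
        by_cases hlt : (a.view.reg ⟨i, p, hp⟩).1 < tup.1
        · change Trans L v₀ w a.view _ (a.view.setServer p (if (a.view.reg ⟨i, p, hp⟩).1 < tup.1
            then _ else _))
          rw [if_pos hlt]
          exact .testLT a.view p i todo tup src hp hs hlt
        · change Trans L v₀ w a.view _ (a.view.setServer p (if (a.view.reg ⟨i, p, hp⟩).1 < tup.1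
            then _ else _))
          rw [if_neg hlt]
          exact .testGE a.view p i todo tup src hp hs (not_lt.1 hlt)
      · obtain ⟨rfl, hb⟩ := step_act h
              (I := .tau { a.view.state p with server := .wloop todo tup src })
              (by simp only [act, hs]; rw [dif_neg hp])
        rw [hb]
        exact .skipTest a.view p i todo tup src hp hs
    · by_cases hp : p ∈ L i
      · obtain ⟨rfl, hb⟩ := step_act h
              (I := .write i hp tup { a.view.state p with server := .wloop todo tup src })
              (by simp only [act, hs]; rw [dif_pos hp])
        rw [hb]
        exact .put a.view p i todo tup src hp hs
      · obtain ⟨rfl, hb⟩ := step_act h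
              (I := .tau { a.view.state p with server := .wloop todo tup src })
              (by simp only [act, hs]; rw [dif_neg hp])
        rw [hb]
        exact .skipPut a.view p i todo tup src hp hs
    · obtain ⟨rfl, hb⟩ := step_act h
              (I := .send src (.ackR c best) { a.view.state p with server := .none })
              (by simp only [act, hs])
      rw [hb]
      exact .sendAckR a.view p best c src hs
    · by_cases hp : p ∈ L i ∧ q ∈ L i
      · obtain ⟨rfl, hb⟩ := step_act h
              (I := .read i ⟨q, hp.2⟩ hp.1 fun y => { a.view.state p with
                server := .rloop todo (maxTup best y) c src })
              (by simp only [act, hs]; rw [dif_pos hp])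
        rw [hb]
        exact .readReg a.view p i q todo best c src hp.1 hp.2 hs
      · obtain ⟨rfl, hb⟩ := step_act h
              (I := .tau { a.view.state p with server := .rloop todo best c src })
              (by simp only [act, hs]; rw [dif_neg hp])
        rw [hb]
        exact .skipReg a.view p i q todo best c src hp hs

end RW
-- Invariants of writing, reading and acknowledging
namespace RW

variable {n m : ℕ} {L : Fin m → Finset (Fin n)} {V : Type u}

/-- All registers owned by `q` hold a sequence number that is at least `k`. -/
def Cfg.Stored (a : Cfg L V) (k : ℕ) (q : Fin n) : Prop :=
  ∀ i (h : q ∈ L i), k ≤ (a.reg ⟨i, q, h⟩).1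

/-- The write handlers are about to increase the registers they write, and acknowledgments are
sent only when the tuple is stored. -/
structure AckInv (a : Cfg L V) : Prop where
  wput : ∀ p i todo tup src, (a.state p).server = .wput i todo tup src →
    (∀ h, (a.reg ⟨i, p, h⟩).1 < tup.1) ∧
      ∀ j (h : p ∈ L j), j ≠ i → j ∉ todo → tup.1 ≤ (a.reg ⟨j, p, h⟩).1
  wloop : ∀ p todo tup src, (a.state p).server = .wloop todo tup src →
    ∀ j (h : p ∈ L j), j ∉ todo → tup.1 ≤ (a.reg ⟨j, p, h⟩).1
  net : ∀ q p k, (q, p, .ackW k) ∈ a.net → a.Stored k q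
  client : ∀ p todo acks tup, (a.state p).client = .writing todo acks tup →
    ∀ q ∈ acks, a.Stored tup.1 q

variable {v₀ : V} {w : Fin n} {a b : Cfg L V} {e : Event n V (Msg V)}

/-- Only `put` changes a register. It follows a test that found a smaller number, and the test is
still valid: only the owner writes this register, and the owner has been busy with this handler
since. -/
theorem AckInv.reg_le (ha : AckInv a) (h : Trans L v₀ w a e b) (ρ : Reg L) :
    (a.reg ρ).1 ≤ (b.reg ρ).1 := by
  cases h with
  | put p i todo tup src hi hs =>
    rcases eq_or_ne ρ ⟨i, p, hi⟩ with rfl | hne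
    · simpa using ((ha.wput p i todo tup src hs).1 hi).le
    · simp [Function.update_of_ne hne]
  | _ => exact le_rfl

theorem AckInv.stored (ha : AckInv a) (h : Trans L v₀ w a e b) {k : ℕ} {q : Fin n}
    (hs : a.Stored k q) : b.Stored k q :=
  fun i hi => (hs i hi).trans (ha.reg_le h _)

/-- An acknowledgment is sent when the list of the handler is empty; at that moment `AckInv.wloop`
covers every register of the sender. -/
theorem AckInv.net_step (ha : AckInv a) (h : Trans L v₀ w a e b) (q p k)
    (hm : (q, p, .ackW k) ∈ b.net) : b.Stored k q := by
  have h0 := ha.reg_le h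
  have h1 := fun hm => ha.stored h (ha.net q p k hm)
  have h2 := ha.wloop q
  cases h <;> grind [Cfg.setServer, Cfg.setClient, Cfg.Stored]

/-- Reduces the preservation of `AckInv.client` to the four possible origins of a writing client:
unchanged, fresh, one request sent, one acknowledgment received. -/
theorem writing_cases (h : Trans L v₀ w a e b) {p todo acks tup}
    (hm : (b.state p).client = .writing todo acks tup) :
    (a.state p).client = .writing todo acks tup ∨ acks = ∅ ∨
      (∃ q, (a.state p).client = .writing (q :: todo) acks tup) ∨
      ∃ q acks', acks = insert q acks' ∧ (a.state p).client = .writing todo acks' tup ∧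
        (q, p, .ackW tup.1) ∈ a.net := by
  cases h <;> (try simp only [Cfg.setServer, Cfg.setClient, Function.update_apply] at hm) <;>
    grind

theorem AckInv.client_step (ha : AckInv a) (h : Trans L v₀ w a e b) (p todo acks tup)
    (hm : (b.state p).client = .writing todo acks tup) : ∀ q ∈ acks, b.Stored tup.1 q := by
  have h1 := fun k q p hm => ha.stored h (ha.net q p k hm)
  have h2 := fun p todo acks tup hm q hq => ha.stored h (ha.client p todo acks tup hm q hq)
  rcases writing_cases h hm with hc | rfl | ⟨q, hc⟩ | ⟨q, acks', rfl, hc, hn⟩ <;> grind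

theorem AckInv.wput_step (ha : AckInv a) (h : Trans L v₀ w a e b) (p i todo tup src)
    (hm : (b.state p).server = .wput i todo tup src) :
    (∀ h, (b.reg ⟨i, p, h⟩).1 < tup.1) ∧
      ∀ j (h : p ∈ L j), j ≠ i → j ∉ todo → tup.1 ≤ (b.reg ⟨j, p, h⟩).1 := by
  have h1 := ha.wput p
  have h2 := ha.wloop p
  cases h <;> (try simp only [Cfg.setServer, Cfg.setClient, Function.update_apply] at hm ⊢) <;> grind

theorem AckInv.wloop_step (ha : AckInv a) (h : Trans L v₀ w a e b) (p todo tup src)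
    (hm : (b.state p).server = .wloop todo tup src) :
    ∀ j (h : p ∈ L j), j ∉ todo → tup.1 ≤ (b.reg ⟨j, p, h⟩).1 := by
  have h0 := ha.reg_le h
  have h1 := ha.wput p
  have h2 := ha.wloop p
  cases h <;> (try simp only [Cfg.setServer, Cfg.setClient, Function.update_apply] at hm h0 ⊢) <;> grind

theorem AckInv.step (ha : AckInv a) (h : Trans L v₀ w a e b) : AckInv b :=
  ⟨ha.wput_step h, ha.wloop_step h, ha.net_step h, ha.client_step h⟩

end RW
namespace RW

variable {n m : ℕ} {L : Fin m → Finset (Fin n)} {V : Type u}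
variable {v₀ : V} {w : Fin n} {a b : Cfg L V} {e : Event n V (Msg V)}

/-- All tuples in the system satisfy `Q`. -/
structure AllTuples (Q : ℕ × V → Prop) (a : Cfg L V) : Prop where
  reg : ∀ ρ, Q (a.reg ρ)
  netW : ∀ p q tup, (p, q, .W tup) ∈ a.net → Q tup
  netAckR : ∀ p q c tup, (p, q, .ackR c tup) ∈ a.net → Q tup
  writing : ∀ p todo acks tup, (a.state p).client = .writing todo acks tup → Q tup
  reading : ∀ p todo acks tup, (a.state p).client = .reading todo acks tup → Q tup
  wloop : ∀ p todo tup src, (a.state p).server = .wloop todo tup src → Q tup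
  wput : ∀ p i todo tup src, (a.state p).server = .wput i todo tup src → Q tup
  rloop : ∀ p todo tup c src, (a.state p).server = .rloop todo tup c src → Q tup

theorem AllTuples.mono {Q Q' : ℕ × V → Prop} (hQ : ∀ tup, Q tup → Q' tup) (h : AllTuples Q a) :
    AllTuples Q' a where
  reg ρ := hQ _ (h.reg ρ)
  netW p q tup hm := hQ _ (h.netW p q tup hm)
  netAckR p q c tup hm := hQ _ (h.netAckR p q c tup hm)
  writing p todo acks tup hm := hQ _ (h.writing p todo acks tup hm)
  reading p todo acks tup hm := hQ _ (h.reading p todo acks tup hm)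
  wloop p todo tup src hm := hQ _ (h.wloop p todo tup src hm)
  wput p i todo tup src hm := hQ _ (h.wput p i todo tup src hm)
  rloop p todo tup c src hm := hQ _ (h.rloop p todo tup c src hm)

theorem maxTup_eq_or (x y : ℕ × V) : maxTup x y = x ∨ maxTup x y = y := by
  unfold maxTup
  split_ifs <;> simp

theorem le_maxTup_left (x y : ℕ × V) : x.1 ≤ (maxTup x y).1 := by
  unfold maxTup
  split_ifs <;> omega

theorem le_maxTup_right (x y : ℕ × V) : y.1 ≤ (maxTup x y).1 := by
  unfold maxTup
  split_ifs <;> omega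

/-- Tuples are only copied or compared, and `maxTup` returns one of its arguments. New tuples come
from calls of write, and `(0, v₀)` from the start of a read or of a scan. -/
theorem AllTuples.step {Q : ℕ × V → Prop} (ha : AllTuples Q a) (h : Trans L v₀ w a e b)
    (h0 : Q (0, v₀)) (hw : ∀ p x, e = .invoke p (.write x) → Q ((a.state p).sn + 1, x)) :
    AllTuples Q b := by
  obtain ⟨h1, h2, h3, h4, h5, h6, h7, h8⟩ := ha
  constructor <;> cases h <;>
    (try simp only [Cfg.setServer, Cfg.setClient, Function.update_apply]) <;>
    grind [maxTup_eq_or]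

/-- Sequence numbers of read requests and their acknowledgments do not exceed the counter of the
requesting process. -/
structure FreshInv (a : Cfg L V) : Prop where
  netR : ∀ p q c, (p, q, .R c) ∈ a.net → c ≤ (a.state p).snr
  netAckR : ∀ p q c tup, (q, p, .ackR c tup) ∈ a.net → c ≤ (a.state p).snr
  rloop : ∀ p q todo tup c, (a.state q).server = .rloop todo tup c p → c ≤ (a.state p).snr

theorem FreshInv.step (ha : FreshInv a) (h : Trans L v₀ w a e b) : FreshInv b := by
  obtain ⟨h1, h2, h3⟩ := ha
  constructor <;> cases h <;>
    (try simp only [Cfg.setServer, Cfg.setClient, Function.update_apply]) <;> grind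

/-- `k` is at least the baseline `B` of all registers that `q` can read. -/
def Covers (B : Reg L → ℕ) (q : Fin n) (k : ℕ) : Prop :=
  ∀ i q', q ∈ L i → ∀ h : q' ∈ L i, B ⟨i, q', h⟩ ≤ k

/-- The replies to request `c` of `p` reflect the contents `B` of the registers. -/
structure ReadInv (p : Fin n) (c : ℕ) (B : Reg L → ℕ) (a : Cfg L V) : Prop where
  reg : ∀ ρ, B ρ ≤ (a.reg ρ).1
  net : ∀ q tup, (q, p, .ackR c tup) ∈ a.net → Covers B q tup.1
  rloop : ∀ q todo tup, (a.state q).server = .rloop todo tup c p →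
    ∀ i q', (i, q') ∉ todo → q ∈ L i → ∀ h : q' ∈ L i, B ⟨i, q', h⟩ ≤ tup.1
  client : (a.state p).snr = c → ∀ todo acks best, (a.state p).client = .reading todo acks best →
    ∀ q ∈ acks, Covers B q best.1

theorem reading_cases (h : Trans L v₀ w a e b) {p todo acks best}
    (hm : (b.state p).client = .reading todo acks best) :
    acks = ∅ ∨ (b.state p).snr = (a.state p).snr ∧
    ((a.state p).client = .reading todo acks best ∨
      (∃ q, (a.state p).client = .reading (q :: todo) acks best) ∨
      ∃ q acks' best' tup, acks = insert q acks' ∧ best = maxTup best' tup ∧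
        (a.state p).client = .reading todo acks' best' ∧
        (q, p, .ackR (a.state p).snr tup) ∈ a.net) := by
  cases h <;> (try simp only [Cfg.setServer, Cfg.setClient, Function.update_apply] at hm ⊢) <;>
    grind

/-- Since registers only grow, whatever a scan finds at any later time is at least the baseline `B`,
and `maxTup` never loses a lower bound that was already reached. -/
theorem ReadInv.step {p c} {B : Reg L → ℕ} (ha : ReadInv p c B a) (hack : AckInv a)
    (h : Trans L v₀ w a e b) : ReadInv p c B b := by
  have hmono := hack.reg_le h
  obtain ⟨h1, h2, h3, h4⟩ := ha
  have h5 : ∀ q tup, (a.state q).server = .rloop [] tup c p → Covers B q tup.1 :=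
    fun q tup hs i q' hi h => h3 q [] tup hs i q' (by simp) hi h
  have h6 : ∀ i q, (i, q) ∈ List.finRange m ×ˢ List.finRange n := by simp
  refine ⟨fun ρ => (h1 ρ).trans (hmono ρ), ?_, ?_, ?_⟩
  · clear hmono h1 h3 h4 h6
    cases h <;> (try simp only [Cfg.setServer, Cfg.setClient, Function.update_apply]) <;> grind
  · clear hmono h2 h4 h5
    cases h <;> (try simp only [Cfg.setServer, Cfg.setClient, Function.update_apply]) <;>
      grind [le_maxTup_left, le_maxTup_right]
  · intro hc todo acks best hm q hq
    rcases reading_cases h hm with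
      rfl | ⟨hs, hr | ⟨q', hr⟩ | ⟨q', acks', best', tup, rfl, rfl, hr, hn⟩⟩
    · simp at hq
    · exact h4 (hs ▸ hc) _ _ _ hr q hq
    · exact h4 (hs ▸ hc) _ _ _ hr q hq
    · rcases Finset.mem_insert.1 hq with rfl | hq
      · rw [← hs, hc] at hn
        exact fun i q' hi h => (h2 _ _ hn i q' hi h).trans (le_maxTup_right _ _)
      · exact fun i q' hi h => (h4 (hs ▸ hc) _ _ _ hr q hq i q' hi h).trans (le_maxTup_left _ _)

/-- A quorum can only read registers whose baseline is at most `k`. -/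
def QuorumCovers (B : Reg L → ℕ) (k : ℕ) : Prop :=
  ∃ Q : Finset (Fin n), n - tL L ≤ Q.card ∧ ∀ q ∈ Q, Covers B q k

/-- `p` is in its `c`-th read operation, and if it has chosen a tuple, then a quorum replied. -/
def ReadPhase (p : Fin n) (c : ℕ) (B : Reg L → ℕ) (a : Cfg L V) : Prop :=
  p ∈ a.pending ∧ (a.state p).snr = c ∧
    ((∃ todo acks best, (a.state p).client = .reading todo acks best) ∨
      ∃ todo acks tup, (a.state p).client = .writing todo acks tup ∧ QuorumCovers B tup.1)

/-- `p` is in `Write(tup)`. -/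
def WritePhase (p : Fin n) (tup : ℕ × V) (a : Cfg L V) : Prop :=
  p ∈ a.pending ∧ ∃ todo acks, (a.state p).client = .writing todo acks tup

/-- Event `e` is a step in which `p` returns `x`. -/
def IsReturn (p : Fin n) (x : V) (a : Cfg L V) (e : Event n V (Msg V)) : Prop :=
  (∃ d, e = .step p d) ∧ Returning L (a.state p) x

theorem not_le_card_of_not_isReturn {p : Fin n} (hr : ∀ x, ¬ IsReturn p x a e)
    (he : e = .step p none) (hs : (a.state p).server = .none) (acks tup)
    (hc : (a.state p).client = .writing [] acks tup) : ¬ n - tL L ≤ acks.card :=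
  fun h => hr tup.2 ⟨⟨_, he⟩, hs, acks, tup, hc, h, rfl⟩

theorem WritePhase.step {p tup} (ha : WritePhase p tup a) (h : Trans L v₀ w a e b)
    (hr : ∀ x, ¬ IsReturn p x a e) : WritePhase p tup b := by
  have hr' := not_le_card_of_not_isReturn hr
  obtain ⟨hp, todo, acks, hc⟩ := ha
  clear hr
  unfold WritePhase
  cases h <;> (try simp only [Cfg.setServer, Cfg.setClient, Function.update_apply]) <;> grind

/-- The quorum is the set of acknowledgments at the moment when the client switches from reading to
writing; the tuple is fixed from then on. -/
theorem ReadPhase.step {p c} {B : Reg L → ℕ} (ha : ReadPhase p c B a) (hi : ReadInv p c B a)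
    (h : Trans L v₀ w a e b) (hr : ∀ x, ¬ IsReturn p x a e) : ReadPhase p c B b := by
  have hr' := not_le_card_of_not_isReturn hr
  obtain ⟨hp, hsnr, ha⟩ := ha
  have h4 : ∀ acks best, (a.state p).client = .reading [] acks best → n - tL L ≤ acks.card →
      QuorumCovers B best.1 := fun acks best hc hcard => ⟨acks, hcard, hi.client hsnr _ _ _ hc⟩
  clear hr hi
  unfold ReadPhase
  rcases ha with ⟨todo, acks, best, hc⟩ | ⟨todo, acks, tup, hc, hQ⟩
  · cases h <;> (try simp only [Cfg.setServer, Cfg.setClient, Function.update_apply]) <;> grind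
  · cases h <;> (try simp only [Cfg.setServer, Cfg.setClient, Function.update_apply]) <;> grind

end RW
-- Calls of operations, and the intersection of quorums
namespace RW

variable {n m : ℕ} {L : Fin m → Finset (Fin n)} {V : Type u}
variable {v₀ : V} {w : Fin n} {a b : Cfg L V} {e : Event n V (Msg V)}

/-- By `FreshInv` no message and no handler carries the new counter value yet, so the conditions on
replies hold vacuously for the baseline of current register contents. -/
theorem readInv_of_invoke {p : Fin n} (h : Trans L v₀ w a (.invoke p .read) b) (hf : FreshInv a) :
    ReadInv p ((a.state p).snr + 1) (fun ρ => (a.reg ρ).1) b ∧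
      ReadPhase p ((a.state p).snr + 1) (fun ρ => (a.reg ρ).1) b := by
  obtain ⟨h1, h2, h3⟩ := hf
  cases h with
  | invokeRead p hp =>
    refine ⟨⟨fun ρ => le_rfl, fun q tup hm => ?_, fun q todo tup hm => ?_,
      fun hs todo acks best hm => ?_⟩, ?_⟩
    · exact absurd (h2 _ _ _ _ hm) (by simp)
    · have hm' : (a.state q).server = .rloop todo tup ((a.state p).snr + 1) p := by
        simp only [Function.update_apply] at hm
        split_ifs at hm with hq
        · rw [hq]
          exact hm
        · exact hm
      exact absurd (h3 _ _ _ _ _ hm') (by simp)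
    · simp at hm
      simp [← hm.2.1]
    · exact ⟨by simp, by simp, Or.inl (by simp)⟩

theorem writePhase_of_invoke {p : Fin n} {x : V} (h : Trans L v₀ w a (.invoke p (.write x)) b) :
    WritePhase p ((a.state p).sn + 1, x) b := by
  cases h with
  | invokeWrite p x hp hw => exact ⟨by simp, _, _, by simp; exact ⟨rfl, rfl⟩⟩

/-- A quorum stores a sequence number that is at least `k`. -/
def QuorumStores (k : ℕ) (a : Cfg L V) : Prop :=
  ∃ Q : Finset (Fin n), n - tL L ≤ Q.card ∧ ∀ q ∈ Q, a.Stored k q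

/-- This is where the definition of `t_L` enters, after both quorums are trimmed to exactly `n -
t_L` members. If they meet in `q`, then `q` scans its own register in some `S_i` that contains it;
otherwise a member `q'` of the reading quorum scans the register `R_i[q]` of a member `q` of the
storing one. -/
theorem le_of_quorums (hL : ∀ p, ∃ i, p ∈ L i) (hn : 0 < n) {s k : ℕ} (h : QuorumStores s a)
    (h' : QuorumCovers (fun ρ => (a.reg ρ).1) k) : s ≤ k := by
  obtain ⟨Q, hQ, hs⟩ := h
  obtain ⟨Q', hQ', hs'⟩ := h'
  obtain ⟨P, hP, hPc⟩ := Finset.exists_subset_card_eq hQ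
  obtain ⟨P', hP', hPc'⟩ := Finset.exists_subset_card_eq hQ'
  rcases (isGreatest_tL hn L).1.2 P P' hPc hPc' with ⟨q, hq⟩ | ⟨i, q, hq, q', hq', hi, hi'⟩
  · rw [Finset.mem_inter] at hq
    obtain ⟨i, hi⟩ := hL q
    exact (hs q (hP hq.1) i hi).trans (hs' q (hP' hq.2) i q hi hi)
  · exact (hs q (hP hq) i hi).trans (hs' q' (hP' hq') i q hi' hi)

theorem sn_of_not_write (h : Trans L v₀ w a e b) (he : ∀ p x, e ≠ .invoke p (.write x)) (q : Fin n) :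
    (b.state q).sn = (a.state q).sn := by
  cases h <;> (try simp only [Cfg.setServer, Cfg.setClient, Function.update_apply]) <;> grind

theorem sn_of_write {p : Fin n} {x : V} (h : Trans L v₀ w a (.invoke p (.write x)) b) :
    p = w ∧ (b.state w).sn = (a.state w).sn + 1 := by
  cases h with
  | invokeWrite p x hp hw => subst hw; simp

end RW

/-! ### Atomicity of the read/write algorithm -/

open RW

namespace Execution

theorem Completes.unique {n m : ℕ} {L : Fin m → Finset (Fin n)} {V : Type u}
    {A : Algorithm.{u, v} L V} {w : Fin n} {E : Execution A w} {o e e' : ℕ} {x x' : V}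
    (h : E.Completes o e x) (h' : E.Completes o e' x') : e = e' ∧ x = x' := by
  obtain ⟨p, f, h1, h2, h3, h4⟩ := h
  obtain ⟨p', f', h1', h2', h3', h4'⟩ := h'
  rw [h1] at h1'
  cases h1'
  rcases lt_trichotomy e e' with hlt | rfl | hlt
  · exact absurd h3 (h4' e h2 hlt x)
  · refine ⟨rfl, ?_⟩
    obtain ⟨-, s, h⟩ := h3
    obtain ⟨-, s', h'⟩ := h3'
    rw [h] at h'
    cases h'
    rfl
  · exact absurd h3' (h4 e' h2' hlt x')

variable {n m : ℕ} {L : Fin m → Finset (Fin n)} {V : Type u} {v₀ : V} {w : Fin n}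
  (E : Execution (rwAlgorithm L v₀) w)

theorem trans (k : ℕ) : Trans L v₀ w (E.cfg k).view (E.ev k) (E.cfg (k + 1)).view :=
  trans_of_step (E.cfg_succ k)

theorem view_cfg_zero : (E.cfg 0).view = ⟨fun _ => ⟨0, 0, .none, .none⟩, 0, fun _ => (0, v₀), ∅⟩ := by
  rw [E.cfg_zero]
  rfl

theorem returns_iff {p : Fin n} {x : V} {k : ℕ} :
    E.Returns p x k ↔ IsReturn p x (E.cfg k).view (E.ev k) :=
  ⟨fun h => ⟨h.1, act_eq_ret h.2.choose_spec⟩, fun h => ⟨h.1, act_of_returning h.2⟩⟩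

theorem ackInv (k : ℕ) : AckInv (E.cfg k).view := by
  induction k with
  | zero => rw [view_cfg_zero]; constructor <;> simp
  | succ k ih => exact ih.step (E.trans k)

theorem freshInv (k : ℕ) : FreshInv (E.cfg k).view := by
  induction k with
  | zero => rw [view_cfg_zero]; constructor <;> simp
  | succ k ih => exact ih.step (E.trans k)

/-- The number of writes that start before time `k`. -/
noncomputable def writeCount (k : ℕ) : ℕ := {o | o < k ∧ ∃ y, E.IsWrite o y}.ncard

theorem writeCount_eq (o : ℕ) : E.writeCount (o + 1) = {o' | o' ≤ o ∧ ∃ y, E.IsWrite o' y}.ncard := by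
  simp only [writeCount, Nat.lt_succ_iff]

theorem writeCount_succ_of_isWrite {k : ℕ} {y : V} (h : E.IsWrite k y) :
    E.writeCount (k + 1) = E.writeCount k + 1 := by
  have : {o | o < k + 1 ∧ ∃ y, E.IsWrite o y} = insert k {o | o < k ∧ ∃ y, E.IsWrite o y} := by
    ext o
    simp only [Set.mem_ofPred_eq, Set.mem_insert_iff, Nat.lt_succ_iff_lt_or_eq]
    constructor
    · rintro ⟨h | h, h'⟩
      · exact Or.inr ⟨h, h'⟩
      · exact Or.inl h
    · rintro (rfl | ⟨h, h'⟩)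
      · exact ⟨Or.inr rfl, _, ‹_›⟩
      · exact ⟨Or.inl h, h'⟩
  rw [writeCount, this, Set.ncard_insert_of_notMem (by simp)
    ((Set.finite_lt_nat k).subset fun o ho => ho.1)]
  rfl

theorem writeCount_succ_of_not {k : ℕ} (h : ∀ y, ¬ E.IsWrite k y) :
    E.writeCount (k + 1) = E.writeCount k := by
  unfold writeCount
  congr 1
  ext o
  simp only [Set.mem_ofPred_eq, Nat.lt_succ_iff_lt_or_eq]
  constructor
  · rintro ⟨h' | rfl, h''⟩
    · exact ⟨h', h''⟩
    · exact absurd h''.choose_spec (h _)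
  · exact fun ⟨h, h'⟩ => ⟨Or.inl h, h'⟩

theorem writeCount_mono : Monotone E.writeCount := by
  refine monotone_nat_of_le_succ fun k => ?_
  by_cases h : ∃ y, E.IsWrite k y
  · rw [E.writeCount_succ_of_isWrite h.choose_spec]
    omega
  · rw [E.writeCount_succ_of_not (not_exists.1 h)]

/-- Only `w` may call write, so its local counter counts all the writes of the execution. Sequence
numbers thus become the indices of `IsValue`. -/
theorem sn_writer (k : ℕ) : ((E.cfg k).view.state w).sn = E.writeCount k := by
  induction k with
  | zero => rw [view_cfg_zero]; simp [writeCount]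
  | succ k ih =>
    by_cases h : ∃ y, E.IsWrite k y
    · rw [E.writeCount_succ_of_isWrite h.choose_spec]
      obtain ⟨y, p, h⟩ := h
      have := E.trans k
      rw [h] at this
      rw [(sn_of_write this).2, ih]
    · rw [E.writeCount_succ_of_not (not_exists.1 h), sn_of_not_write (E.trans k) _ w, ih]
      exact fun p x hx => h ⟨x, p, hx⟩

/-- The tuple is the starting tuple or belongs to a write that starts before time `k`. -/
def Written (k : ℕ) (tup : ℕ × V) : Prop :=
  (tup.1 = 0 ∧ tup.2 = v₀) ∨ ∃ o < k, E.IsWrite o tup.2 ∧ E.writeCount (o + 1) = tup.1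

theorem allTuples (k : ℕ) : AllTuples (E.Written k) (E.cfg k).view := by
  induction k with
  | zero => rw [view_cfg_zero]; constructor <;> simp [Written]
  | succ k ih =>
    refine AllTuples.step (ih.mono fun tup h => ?_) (E.trans k) (Or.inl ⟨rfl, rfl⟩) ?_
    · exact h.imp_right fun ⟨o, ho, h⟩ => ⟨o, ho.trans k.lt_succ_self, h⟩
    · intro p x hx
      have ht := E.trans k
      rw [hx] at ht
      obtain ⟨rfl, -⟩ := sn_of_write ht
      refine Or.inr ⟨k, k.lt_succ_self, ⟨p, hx⟩, ?_⟩
      rw [E.writeCount_succ_of_isWrite ⟨p, hx⟩, E.sn_writer]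

theorem quorumStores_mono {s k k' : ℕ} (hk : k ≤ k') (h : QuorumStores s (E.cfg k).view) :
    QuorumStores s (E.cfg k').view := by
  induction k', hk using Nat.le_induction with
  | base => exact h
  | succ k' _ ih =>
    obtain ⟨Q, hQ, hs⟩ := ih
    exact ⟨Q, hQ, fun q hq => (E.ackInv k').stored (E.trans k') (hs q hq)⟩

/-- The client stays in `Write` with the same tuple until it returns. It then holds `n - t_L`
acknowledgments, each of which certifies storage by `AckInv.client`. -/
theorem quorumStores_of_write {o e : ℕ} {x y : V} (hw : E.IsWrite o x) (hc : E.Completes o e y) :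
    QuorumStores (E.writeCount (o + 1)) (E.cfg e).view := by
  obtain ⟨p, hp⟩ := hw
  obtain ⟨p', f, hp', hlt, hret, hnot⟩ := hc
  rw [hp] at hp'
  cases hp'
  have ht := E.trans o
  rw [hp] at ht
  have h0 := writePhase_of_invoke ht
  obtain ⟨rfl, -⟩ := sn_of_write ht
  rw [E.sn_writer, ← E.writeCount_succ_of_isWrite ⟨p, hp⟩] at h0
  have h1 : ∀ k, o + 1 ≤ k → k ≤ e → WritePhase p (E.writeCount (o + 1), x) (E.cfg k).view := by
    intro k hk
    induction k, hk using Nat.le_induction with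
    | base => exact fun _ => h0
    | succ k hk ih =>
      exact fun hke => (ih (by omega)).step (E.trans k) fun y hy =>
        hnot k (by omega) (by omega) y (E.returns_iff.2 hy)
  obtain ⟨-, todo, acks, hcl⟩ := h1 e hlt le_rfl
  obtain ⟨-, -, acks', tup, hcl', hcard, -⟩ := E.returns_iff.1 hret
  rw [hcl] at hcl'
  cases hcl'
  exact ⟨acks, hcard, (E.ackInv e).client p _ _ _ hcl⟩

/-- The whole content of atomicity about one read. The bound on `s` comes from the query phase,
whose scans all follow the call and hence dominate the registers at time `r`; the storage of `k`
comes from the write-back. -/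
theorem read_spec (hL : ∀ p, ∃ i, p ∈ L i) {r e : ℕ} {p : Fin n} {x : V}
    (hr : E.ev r = .invoke p .read) (hc : E.Completes r e x) :
    ∃ k, E.Written e (k, x) ∧ QuorumStores k (E.cfg e).view ∧
      ∀ s, QuorumStores s (E.cfg r).view → s ≤ k := by
  obtain ⟨p', f, hp', hlt, hret, hnot⟩ := hc
  rw [hr] at hp'
  cases hp'
  have ht := E.trans r
  rw [hr] at ht
  obtain ⟨h0, h0'⟩ := readInv_of_invoke ht (E.freshInv r)
  set c := ((E.cfg r).view.state p).snr + 1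
  set B : Reg L → ℕ := fun ρ => ((E.cfg r).view.reg ρ).1
  have h1 : ∀ k, r + 1 ≤ k → ReadInv p c B (E.cfg k).view := by
    intro k hk
    induction k, hk using Nat.le_induction with
    | base => exact h0
    | succ k hk ih => exact ih.step (E.ackInv k) (E.trans k)
  have h2 : ∀ k, r + 1 ≤ k → k ≤ e → ReadPhase p c B (E.cfg k).view := by
    intro k hk
    induction k, hk using Nat.le_induction with
    | base => exact fun _ => h0'
    | succ k hk ih =>
      exact fun hke => (ih (by omega)).step (h1 k hk) (E.trans k) fun y hy =>
        hnot k (by omega) (by omega) y (E.returns_iff.2 hy)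
  obtain ⟨-, -, acks, tup, hcl, hcard, rfl⟩ := E.returns_iff.1 hret
  refine ⟨tup.1, (E.allTuples e).writing p _ _ _ hcl,
    ⟨acks, hcard, (E.ackInv e).client p _ _ _ hcl⟩, fun s hs => ?_⟩
  obtain ⟨-, -, ⟨todo, acks', best, hcl'⟩ | ⟨todo, acks', tup', hcl', hQ⟩⟩ := h2 e hlt le_rfl
  · rw [hcl] at hcl'
    cases hcl'
  · rw [hcl] at hcl'
    cases hcl'
    exact le_of_quorums hL p.pos hs hQ

/-- The number `k` of the returned tuple is at least the number of every write that precedes the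
read. If `k = 0`, there is no such write. Otherwise `k` belongs to a write `o` that starts before
the read returns, so the read does not precede `o`; and a write between `o` and the read would have
a number above `k`. -/
theorem rw_property1 (hL : ∀ p, ∃ i, p ∈ L i) : E.Property1 v₀ := by
  rintro r x ⟨⟨p, hr⟩, e, hc⟩
  obtain ⟨k, hk, -, hmax⟩ := E.read_spec hL hr hc
  have hpre : ∀ o y, E.IsWrite o y → E.Precedes o r → E.writeCount (o + 1) ≤ k := by
    rintro o y hw ⟨e', y', hc', hlt⟩
    exact hmax _ (E.quorumStores_mono hlt.le (E.quorumStores_of_write hw hc'))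
  rcases hk with ⟨hk, hx⟩ | ⟨o, ho, hw, hk⟩
  · refine Or.inr ⟨fun o y hw h => ?_, hx⟩
    have := hpre o y hw h
    rw [E.writeCount_succ_of_isWrite hw] at this
    dsimp only at hk
    omega
  · refine Or.inl ⟨o, hw, ?_⟩
    by_cases h : E.Precedes o r
    · refine Or.inl ⟨h, ?_⟩
      rintro ⟨o', y, hw', ⟨e', y', hc', hlt⟩, h2⟩
      have h3 := hpre o' y hw' h2
      have h4 : o < e' := hc'.choose_spec.choose_spec.2.1
      rw [E.writeCount_succ_of_isWrite hw'] at h3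
      have := E.writeCount_mono (show o + 1 ≤ o' by omega)
      dsimp only at hk
      omega
    · refine Or.inr ⟨h, ?_⟩
      rintro ⟨e', y', hc', hlt⟩
      have := (hc.unique hc').1
      omega

theorem rw_property2 (hL : ∀ p, ∃ i, p ∈ L i) (hd : E.DistinctWrites v₀) : E.Property2 v₀ := by
  -- As the written values are distinct and differ from `v₀`, a value determines its index, which
  -- must be the sequence number of the tuple that carries it.
  have huniq : ∀ e k k' x, E.Written e (k, x) → E.IsValue v₀ k' x → k' = k := by
    intro e k k' x h h'
    rcases h with ⟨h1, h2⟩ | ⟨o, -, h2, h3⟩ <;> rcases h' with ⟨h1', h2'⟩ | ⟨o', h2', h3'⟩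
    · exact h1'.trans h1.symm
    · exact absurd h2 (hd.1 _ _ h2')
    · exact absurd h2' (hd.1 _ _ h2)
    · obtain rfl := hd.2 _ _ _ h2 h2'
      rw [← h3', ← E.writeCount_eq]
      exact h3
  rintro r r' x x' k k' ⟨⟨p, hr⟩, e, hc⟩ ⟨⟨p', hr'⟩, e', hc'⟩ hk hk' ⟨e₁, x₁, hc₁, hlt⟩
  obtain ⟨rfl, rfl⟩ := hc.unique hc₁
  obtain ⟨j, hj, hst, -⟩ := E.read_spec hL hr hc
  obtain ⟨j', hj', -, hmax⟩ := E.read_spec hL hr' hc'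
  rw [huniq _ _ _ _ hj hk, huniq _ _ _ _ hj' hk']
  exact hmax _ (E.quorumStores_mono hlt.le hst)

end Execution

/-! ### Termination of the read/write algorithm -/

/-- Two empty sets violate `Overlapping L n`. Hence quorums are nonempty, and a client without
acknowledgments cannot go on. -/
theorem tL_lt {n m : ℕ} (hn : 0 < n) (L : Fin m → Finset (Fin n)) : tL L < n := by
  obtain ⟨h1, h2⟩ := (isGreatest_tL hn L).1
  refine lt_of_le_of_ne h1 fun h => ?_
  rw [h] at h2
  rcases h2 ∅ ∅ (by simp) (by simp) with h | ⟨i, q, hq, -⟩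
  · simp at h
  · simp at hq

namespace RW

variable {n m : ℕ} {L : Fin m → Finset (Fin n)} {V : Type u}
variable {v₀ : V} {w : Fin n} {a b : Cfg L V} {e : Event n V (Msg V)}

/-- Processes in `Write` or `Read` have a pending operation. -/
def PendingInv (a : Cfg L V) : Prop := ∀ p, p ∉ a.pending → (a.state p).client = .none

theorem PendingInv.step (ha : PendingInv a) (h : Trans L v₀ w a e b) : PendingInv b := by
  unfold PendingInv at *
  cases h <;> (try simp only [Cfg.setServer, Cfg.setClient, Function.update_apply]) <;> grind

/-- A bound for the number of steps until a handler ends. -/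
def serverWork : Server n m V → ℕ
  | .none => 0
  | .wloop todo _ _ => 2 * todo.length + 1
  | .wput _ todo _ _ => 2 * todo.length + 2
  | .rloop todo _ _ _ => todo.length + 1

/-- A bound for the number of steps, without those of handlers, until a process tries to receive
a message. -/
noncomputable def clientWork (L : Fin m → Finset (Fin n)) : Client n V → ℕ
  | .none => n + 1
  | .writing todo acks _ => todo.length + if n - tL L ≤ acks.card then n + 2 else 0
  | .reading todo acks _ => todo.length + if n - tL L ≤ acks.card then n + 1 else 0

noncomputable def work (L : Fin m → Finset (Fin n)) (s : State n m V) : ℕ :=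
  serverWork s.server + clientWork L s.client

/-- The constants of `clientWork` pay for the work created without polling. A call or a switch from
reading to writing creates `n` sends, which is below the value `n + 1` of an idle client and of a
read with a quorum; a write with a quorum becomes idle when it returns, hence `n + 2`. In
`serverWork`, a write handler needs up to two steps per index, a test and a put. -/
theorem work_step (ha : PendingInv a) (h : Trans L v₀ w a e b) (p : Fin n) :
    ((∃ d, e = .step p d) ∧ Polling L (a.state p)) ∨
      work L (b.state p) ≤ work L (a.state p) ∧
        ((∃ d, e = .step p d) → work L (b.state p) < work L (a.state p)) := by
  have hn := tL_lt p.pos L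
  have hn' : n - tL L ≠ 0 := by omega
  cases h with
  | idle | crash => right; simp
  | invokeWrite q x hp hw =>
    right
    rcases eq_or_ne p q with rfl | hne
    · simp [work, ha p hp, clientWork, hn']
    · simp [hne]
  | invokeRead q hp =>
    right
    rcases eq_or_ne p q with rfl | hne
    · simp [work, ha p hp, clientWork, hn']
    · simp [hne]
  | recvNone q hp | recvW q _ _ _ hp | recvR q _ _ _ hp | recvAckW q _ _ _ _ hp
  | recvAckR q _ _ _ _ _ hp | dropAckW q _ _ _ hp | dropAckR q _ _ _ _ hp =>
    rcases eq_or_ne p q with rfl | hne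
    · exact Or.inl ⟨⟨_, rfl⟩, hp⟩
    · right; simp [Cfg.setServer, Cfg.setClient, hne, hne.symm]
  | testLT q i todo tup src h hs | testGE q i todo tup src h hs | skipTest q i todo tup src h hs
  | put q i todo tup src h hs | skipPut q i todo tup src h hs | sendAckW q tup src hs
  | readReg q i q' todo best c src h h' hs | skipReg q i q' todo best c src h hs
  | sendAckR q best c src hs =>
    rcases eq_or_ne p q with rfl | hne
    · right; simp [Cfg.setServer, work, hs, serverWork]; try omega
    · right; simp [Cfg.setServer, hne, hne.symm]
  | sendW q q' todo acks tup hs hc | ret q acks tup hs hc hcard | sendR q q' todo acks tup hs hc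
  | switch q acks best hs hc hcard =>
    rcases eq_or_ne p q with rfl | hne
    · right; simp only [Cfg.setClient, work, hs, hc, clientWork, Function.update_self]; simp <;> grind
    · right; simp [Cfg.setClient, hne, hne.symm]

theorem wserver_step {q src : Fin n} {tup} (h : Trans L v₀ w a e b)
    (hs : (∃ todo, (a.state q).server = .wloop todo tup src) ∨
      ∃ i todo, (a.state q).server = .wput i todo tup src) :
    (q, src, .ackW tup.1) ∈ b.net ∨ (∃ todo, (b.state q).server = .wloop todo tup src) ∨
      ∃ i todo, (b.state q).server = .wput i todo tup src := by
  rcases hs with ⟨todo, hs⟩ | ⟨i, todo, hs⟩ <;> cases h <;>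
    (try simp only [Cfg.setServer, Cfg.setClient, Function.update_apply]) <;> grind [Polling]

theorem rserver_step {q src : Fin n} {c} (h : Trans L v₀ w a e b)
    (hs : ∃ todo best, (a.state q).server = .rloop todo best c src) :
    (∃ tup, (q, src, .ackR c tup) ∈ b.net) ∨
      ∃ todo best, (b.state q).server = .rloop todo best c src := by
  rcases hs with ⟨todo, best, hs⟩
  cases h <;>
    (try simp only [Cfg.setServer, Cfg.setClient, Function.update_apply]) <;> grind [Polling]

theorem server_of_recvW {q src : Fin n} {tup}
    (h : Trans L v₀ w a (.step q (some (src, .W tup))) b) :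
    ∃ todo, (b.state q).server = .wloop todo tup src := by
  cases h; simp [Cfg.setServer]

theorem server_of_recvR {q src : Fin n} {c}
    (h : Trans L v₀ w a (.step q (some (src, .R c))) b) :
    ∃ todo best, (b.state q).server = .rloop todo best c src := by
  cases h; simp [Cfg.setServer]

theorem writing_step {p : Fin n} {todo acks tup} (h : Trans L v₀ w a e b) (hp : p ∈ a.pending)
    (hc : (a.state p).client = .writing todo acks tup) (hr : ∀ x, ¬ IsReturn p x a e) :
    p ∈ b.pending ∧ ∃ todo' acks', (b.state p).client = .writing todo' acks' tup ∧ acks ⊆ acks' ∧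
      (todo' = todo ∨ ∃ q, todo = q :: todo' ∧ (p, q, .W tup) ∈ b.net) ∧
      ∀ q, e = .step p (some (q, .ackW tup.1)) → q ∈ acks' := by
  have hr' := not_le_card_of_not_isReturn hr
  clear hr
  cases h <;> (try simp only [Cfg.setServer, Cfg.setClient, Function.update_apply]) <;> grind

theorem reading_step {p : Fin n} {todo acks best} (h : Trans L v₀ w a e b) (hp : p ∈ a.pending)
    (hc : (a.state p).client = .reading todo acks best) :
    p ∈ b.pending ∧ ((∃ best, (b.state p).client = .writing (List.finRange n) ∅ best) ∨
      (b.state p).snr = (a.state p).snr ∧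
      ∃ todo' acks' best', (b.state p).client = .reading todo' acks' best' ∧ acks ⊆ acks' ∧
      (todo' = todo ∨ ∃ q, todo = q :: todo' ∧ (p, q, .R (a.state p).snr) ∈ b.net) ∧
      ∀ q tup, e = .step p (some (q, .ackR (a.state p).snr tup)) → q ∈ acks') := by
  cases h <;> (try simp only [Cfg.setServer, Cfg.setClient, Function.update_apply]) <;> grind

end RW

open RW

namespace Execution

variable {n m : ℕ} {L : Fin m → Finset (Fin n)} {V : Type u} {v₀ : V} {w : Fin n}
  (E : Execution (rwAlgorithm L v₀) w)

theorem pendingInv (k : ℕ) : PendingInv (E.cfg k).view := by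
  induction k with
  | zero => rw [view_cfg_zero]; intro p _; rfl
  | succ k ih => exact ih.step (E.trans k)

theorem polls_iff {p : Fin n} {k : ℕ} :
    E.Polls p k ↔ (∃ d, E.ev k = .step p d) ∧ Polling L ((E.cfg k).view.state p) :=
  ⟨fun h => ⟨h.1, (act_eq_recv h.2.choose_spec).1⟩, fun h => ⟨h.1, _, act_of_polling h.2⟩⟩

variable {E} {p : Fin n}

/-- Strong induction on `work`: as long as `p` does not poll, no event increases its work, and each
of its own infinitely many steps decreases it. -/
theorem Fair.polls (hE : E.Fair) (hp : p ∉ E.faulty) (k : ℕ) : ∃ k' ≥ k, E.Polls p k' := by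
  induction hN : work L ((E.cfg k).view.state p) using Nat.strong_induction_on generalizing k with
  | _ N ih =>
    subst hN
    by_contra! hno
    obtain ⟨k', hk', d, hd⟩ := hE.steps p hp k
    have hle : ∀ j ≥ k, work L ((E.cfg j).view.state p) ≤ work L ((E.cfg k).view.state p) := by
      intro j hj
      induction j, hj using Nat.le_induction with
      | base => exact le_rfl
      | succ j hj ihj =>
        rcases work_step (E.pendingInv j) (E.trans j) p with h | h
        · exact absurd (E.polls_iff.2 h) (hno j hj)
        · exact h.1.trans ihj
    rcases work_step (E.pendingInv k') (E.trans k') p with h | h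
    · exact hno k' hk' (E.polls_iff.2 h)
    · obtain ⟨j, hj, hpoll⟩ := ih _ ((h.2 ⟨d, hd⟩).trans_le (hle k' hk')) (k' + 1) rfl
      exact hno j (by omega) hpoll

theorem Fair.received (hE : E.Fair) (hp : p ∉ E.faulty) {q : Fin n} {c : Msg V} {k : ℕ}
    (h : (q, p, c) ∈ (E.cfg k).view.net) : ∃ k' ≥ k, E.ev k' = .step p (some (q, c)) :=
  hE.links p hp (hE.polls hp) q c k h

/-- A process does not poll while a handler runs. As `q` polls again, its handler must end, and it
ends only by sending the acknowledgment. -/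
theorem Fair.ackW_sent (hE : E.Fair) {q : Fin n} (hq : q ∉ E.faulty) {tup : ℕ × V} {k : ℕ}
    (h : E.ev k = .step q (some (p, .W tup))) :
    ∃ k' ≥ k, (q, p, .ackW tup.1) ∈ (E.cfg k').view.net := by
  by_contra! hno
  have h0 := E.trans k
  rw [h] at h0
  have h1 : ∀ j ≥ k + 1, (∃ todo, ((E.cfg j).view.state q).server = .wloop todo tup p) ∨
      ∃ i todo, ((E.cfg j).view.state q).server = .wput i todo tup p := by
    intro j hj
    induction j, hj using Nat.le_induction with
    | base => exact Or.inl (server_of_recvW h0)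
    | succ j hj ihj => exact (wserver_step (E.trans j) ihj).resolve_left (hno _ (by omega))
  obtain ⟨j, hj, hpoll⟩ := hE.polls hq (k + 1)
  have hs := (E.polls_iff.1 hpoll).2.1
  rcases h1 j hj with ⟨_, h⟩ | ⟨_, _, h⟩ <;> simp [hs] at h

theorem Fair.ackR_sent (hE : E.Fair) {q : Fin n} (hq : q ∉ E.faulty) {c : ℕ} {k : ℕ}
    (h : E.ev k = .step q (some (p, .R c))) :
    ∃ k' ≥ k, ∃ tup, (q, p, .ackR c tup) ∈ (E.cfg k').view.net := by
  by_contra! hno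
  have h0 := E.trans k
  rw [h] at h0
  have h1 : ∀ j ≥ k + 1, ∃ todo best, ((E.cfg j).view.state q).server = .rloop todo best c p := by
    intro j hj
    induction j, hj using Nat.le_induction with
    | base => exact server_of_recvR h0
    | succ j hj ihj =>
      exact (rserver_step (E.trans j) ihj).resolve_left fun ⟨tup, h⟩ => hno _ (by omega) tup h
  obtain ⟨j, hj, hpoll⟩ := hE.polls hq (k + 1)
  have hs := (E.polls_iff.1 hpoll).2.1
  obtain ⟨_, _, h⟩ := h1 j hj
  simp [hs] at h

/-- A correct process cannot wait forever for acknowledgments of the messages it sends to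
everyone. -/
theorem Fair.quorum_replies (hE : E.Fair) (hp : p ∉ E.faulty) (hf : E.faulty.ncard ≤ tL L)
    {a : ℕ} (todo : ℕ → List (Fin n)) (acks : ℕ → Finset (Fin n)) (req : Msg V)
    (ack : Msg V → Prop) (h0 : todo a = List.finRange n)
    (hmono : ∀ k ≥ a, acks k ⊆ acks (k + 1))
    (hsend : ∀ k ≥ a, todo (k + 1) = todo k ∨
      ∃ q, todo k = q :: todo (k + 1) ∧ (p, q, req) ∈ (E.cfg (k + 1)).view.net)
    (hack : ∀ k ≥ a, ∀ q c, ack c → E.ev k = .step p (some (q, c)) → q ∈ acks (k + 1))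
    (hpoll : ∀ k ≥ a, E.Polls p k → todo k = [] ∧ (acks k).card < n - tL L)
    (hsrv : ∀ q ∉ E.faulty, ∀ k, E.ev k = .step q (some (p, req)) →
      ∃ k' ≥ k, ∃ c, ack c ∧ (q, p, c) ∈ (E.cfg k').view.net) : False := by
  have hmono' : ∀ k ≥ a, ∀ k' ≥ k, acks k ⊆ acks k' := by
    intro k hk k' hk'
    induction k', hk' using Nat.le_induction with
    | base => exact subset_rfl
    | succ j hj ih => exact ih.trans (hmono j (by omega))
  have hsent : ∀ k ≥ a, ∀ q, q ∈ todo k ∨ ∃ j ≥ a, (p, q, req) ∈ (E.cfg j).view.net := by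
    intro k hk
    induction k, hk using Nat.le_induction with
    | base => simp [h0]
    | succ k hk ih =>
      intro q
      rcases ih q with h | h
      · rcases hsend k hk with h' | ⟨q', h', hn⟩
        · exact Or.inl (h' ▸ h)
        · rw [h'] at h
          rcases List.mem_cons.1 h with rfl | h
          · exact Or.inr ⟨k + 1, by omega, hn⟩
          · exact Or.inl h
      · exact Or.inr h
  -- A full round trip: at a poll all requests have been sent, so `q` receives its request, replies,
  -- and `p` receives the reply.
  have hall : ∀ q ∉ E.faulty, ∃ K ≥ a, q ∈ acks K := by
    intro q hq
    obtain ⟨k, hk, hpk⟩ := hE.polls hp a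
    rcases hsent k hk q with h | ⟨j, hj, hn⟩
    · simp [(hpoll k hk hpk).1] at h
    · obtain ⟨j₁, hj₁, h₁⟩ := hE.received hq hn
      obtain ⟨j₂, hj₂, c, hc, h₂⟩ := hsrv q hq j₁ h₁
      obtain ⟨j₃, hj₃, h₃⟩ := hE.received hp h₂
      exact ⟨j₃ + 1, by omega, hack j₃ (by omega) q c hc h₃⟩
  -- For faulty `q` the time `K q` is arbitrary, which is harmless in the supremum. At a poll after
  -- all these times, every correct process has acknowledged; these are at least `n - t_L`, too many
  -- for a polling client.
  choose! K hKa hK using hall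
  obtain ⟨k, hk, hpk⟩ := hE.polls hp (a + Finset.univ.sup K)
  have hsub : (E.faulty)ᶜ ⊆ (acks k : Set (Fin n)) := fun q hq =>
    hmono' _ (hKa q hq) k (by
      have := Finset.le_sup (f := K) (Finset.mem_univ q)
      omega) (hK q hq)
  have h1 := Set.ncard_le_ncard hsub
  rw [Set.ncard_coe_finset] at h1
  have h2 := Set.ncard_add_ncard_compl E.faulty
  rw [Nat.card_eq_fintype_card, Fintype.card_fin] at h2
  have h3 := (hpoll k (by omega) hpk).2
  omega

/-- Starts from any fresh writing client, so it serves for calls of write as well as for the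
write-back of a read. If the client never returned, its `todo` and `acks` as functions of time would
contradict `Fair.quorum_replies`. -/
theorem Fair.write_returns (hE : E.Fair) (hp : p ∉ E.faulty) (hf : E.faulty.ncard ≤ tL L)
    {a : ℕ} {tup : ℕ × V} (hpend : p ∈ (E.cfg a).view.pending)
    (hc : ((E.cfg a).view.state p).client = .writing (List.finRange n) ∅ tup) :
    ∃ k ≥ a, ∃ x, E.Returns p x k := by
  by_contra! hno
  have hno' : ∀ k ≥ a, ∀ x, ¬ IsReturn p x (E.cfg k).view (E.ev k) :=
    fun k hk x h => hno k hk x (E.returns_iff.2 h)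
  have hphase : ∀ k ≥ a, p ∈ (E.cfg k).view.pending ∧
      ∃ todo acks, ((E.cfg k).view.state p).client = .writing todo acks tup := by
    intro k hk
    induction k, hk using Nat.le_induction with
    | base => exact ⟨hpend, _, _, hc⟩
    | succ k hk ih =>
      obtain ⟨h, todo, acks, h'⟩ := ih
      obtain ⟨h1, t, s, h2, -⟩ := writing_step (E.trans k) h h' (hno' k hk)
      exact ⟨h1, t, s, h2⟩
  choose! hpd todo acks hcl using hphase
  have hstep : ∀ k ≥ a, acks k ⊆ acks (k + 1) ∧
      (todo (k + 1) = todo k ∨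
        ∃ q, todo k = q :: todo (k + 1) ∧ (p, q, .W tup) ∈ (E.cfg (k + 1)).view.net) ∧
      ∀ q, E.ev k = .step p (some (q, .ackW tup.1)) → q ∈ acks (k + 1) := by
    intro k hk
    obtain ⟨-, t, s, h2, h3⟩ := writing_step (E.trans k) (hpd k hk) (hcl k hk) (hno' k hk)
    rw [hcl (k + 1) (by omega)] at h2
    cases h2
    exact h3
  refine hE.quorum_replies hp hf todo acks (.W tup) (· = .ackW tup.1) ?_
    (fun k hk => (hstep k hk).1) (fun k hk => (hstep k hk).2.1) ?_ ?_ ?_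
  · have := hcl a le_rfl
    rw [hc] at this
    injection this with h1
    exact h1.symm
  · rintro k hk q c rfl h
    exact (hstep k hk).2.2 q h
  · intro k hk hpoll
    have h1 := hcl k hk
    obtain ⟨-, h | ⟨s, t, h, hlt⟩ | ⟨s, t, h, -⟩⟩ := (E.polls_iff.1 hpoll).2
    · simp [h1] at h
    · rw [h1] at h
      injection h with h2 h3
      exact ⟨h2, h3 ▸ hlt⟩
    · simp [h1] at h
  · intro q hq k hk
    obtain ⟨k', hk', h⟩ := hE.ackW_sent hq hk
    exact ⟨k', hk', _, rfl, h⟩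

theorem Fair.read_switches (hE : E.Fair) (hp : p ∉ E.faulty) (hf : E.faulty.ncard ≤ tL L)
    {a : ℕ} {tup : ℕ × V} (hpend : p ∈ (E.cfg a).view.pending)
    (hc : ((E.cfg a).view.state p).client = .reading (List.finRange n) ∅ tup) :
    ∃ k ≥ a, p ∈ (E.cfg k).view.pending ∧
      ∃ best, ((E.cfg k).view.state p).client = .writing (List.finRange n) ∅ best := by
  by_contra! hno
  have hphase : ∀ k ≥ a, p ∈ (E.cfg k).view.pending ∧
      ((E.cfg k).view.state p).snr = ((E.cfg a).view.state p).snr ∧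
      ∃ todo acks best, ((E.cfg k).view.state p).client = .reading todo acks best := by
    intro k hk
    induction k, hk using Nat.le_induction with
    | base => exact ⟨hpend, rfl, _, _, _, hc⟩
    | succ k hk ih =>
      obtain ⟨h, hs, todo, acks, best, h'⟩ := ih
      obtain ⟨h1, ⟨b, hb⟩ | ⟨hs', t, s, b, h2, -⟩⟩ := reading_step (E.trans k) h h'
      · exact absurd hb (hno (k + 1) (by omega) h1 b)
      · exact ⟨h1, hs'.trans hs, t, s, b, h2⟩
  choose! hpd hsnr todo acks best hcl using hphase
  set c := ((E.cfg a).view.state p).snr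
  have hstep : ∀ k ≥ a, acks k ⊆ acks (k + 1) ∧
      (todo (k + 1) = todo k ∨
        ∃ q, todo k = q :: todo (k + 1) ∧ (p, q, .R c) ∈ (E.cfg (k + 1)).view.net) ∧
      ∀ q tup, E.ev k = .step p (some (q, .ackR c tup)) → q ∈ acks (k + 1) := by
    intro k hk
    obtain ⟨h1, ⟨b, hb⟩ | ⟨hs', t, s, b, h2, h3⟩⟩ := reading_step (E.trans k) (hpd k hk) (hcl k hk)
    · exact absurd hb (hno (k + 1) (by omega) h1 b)
    · rw [hcl (k + 1) (by omega)] at h2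
      cases h2
      rw [hsnr k hk] at h3
      exact h3
  refine hE.quorum_replies hp hf todo acks (.R c) (fun x => ∃ tup, x = .ackR c tup) ?_
    (fun k hk => (hstep k hk).1) (fun k hk => (hstep k hk).2.1) ?_ ?_ ?_
  · have := hcl a le_rfl
    rw [hc] at this
    injection this with h1
    exact h1.symm
  · rintro k hk q _ ⟨tup, rfl⟩ h
    exact (hstep k hk).2.2 q tup h
  · intro k hk hpoll
    have h1 := hcl k hk
    obtain ⟨-, h | ⟨s, t, h, -⟩ | ⟨s, t, h, hlt⟩⟩ := (E.polls_iff.1 hpoll).2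
    · simp [h1] at h
    · simp [h1] at h
    · rw [h1] at h
      injection h with h2 h3
      exact ⟨h2, h3 ▸ hlt⟩
  · intro q hq k hk
    obtain ⟨k', hk', tup, h⟩ := hE.ackR_sent hq hk
    exact ⟨k', hk', _, ⟨tup, rfl⟩, h⟩

theorem Fair.rw_terminating (hE : E.Fair) (hf : E.faulty.ncard ≤ tL L) : E.Terminating := by
  intro o p f ho hp
  have hret : ∃ k > o, ∃ x, E.Returns p x k := by
    have ht := E.trans o
    rw [ho] at ht
    rcases f with x | _
    · have h : p ∈ (E.cfg (o + 1)).view.pending ∧ ∃ tup,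
          ((E.cfg (o + 1)).view.state p).client = .writing (List.finRange n) ∅ tup := by
        generalize (E.cfg (o + 1)).view = b at ht
        cases ht
        simp
      obtain ⟨k, hk, hx⟩ := hE.write_returns hp hf h.1 h.2.choose_spec
      exact ⟨k, hk, hx⟩
    · have h : p ∈ (E.cfg (o + 1)).view.pending ∧ ∃ tup,
          ((E.cfg (o + 1)).view.state p).client = .reading (List.finRange n) ∅ tup := by
        generalize (E.cfg (o + 1)).view = b at ht
        cases ht
        simp
      obtain ⟨j, hj, h1, best, h2⟩ := hE.read_switches hp hf h.1 h.2.choose_spec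
      obtain ⟨k, hk, hx⟩ := hE.write_returns hp hf h1 h2
      exact ⟨k, by omega, hx⟩
  classical
  -- `Completes` refers to the first return after the call, hence the least such time.
  obtain ⟨hlt, x, hx⟩ := Nat.find_spec hret
  refine ⟨Nat.find hret, x, p, f, ho, hlt, hx, fun k hk hk' y hy => ?_⟩
  exact Nat.find_min hret hk' ⟨hk, y, hy⟩

end Execution

theorem rwAlgorithm_implements {n m : ℕ} {L : Fin m → Finset (Fin n)} (hL : ∀ p, ∃ i, p ∈ L i)
    {V : Type u} (v₀ : V) (w : Fin n) : Implements (rwAlgorithm L v₀) w v₀ (tL L) :=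
  fun E hE hf hd => ⟨hE.rw_terminating hf, E.rw_property1 hL, E.rw_property2 hL hd⟩


/-! ### Runs from arbitrary configurations, and a fair scheduler -/

variable {n m : ℕ} {L : Fin m → Finset (Fin n)} {V : Type u}

/-- A sequence of transitions from an arbitrary configuration. -/
structure Run (A : Algorithm.{u, v} L V) (w : Fin n) where
  cfg : ℕ → Config A
  ev : ℕ → Event n V A.Msg
  cfg_succ : ∀ k, Step w (cfg k) (ev k) (cfg (k + 1))

variable {A : Algorithm.{u, v} L V} {w : Fin n}

namespace Run

def Polls (R : Run A w) (p : Fin n) (k : ℕ) : Prop :=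
  (∃ d, R.ev k = .step p d) ∧ ∃ f, A.act p ((R.cfg k).state p) = .recv f

/-- Fairness towards the processes that have not crashed at the beginning. -/
structure Fair (R : Run A w) : Prop where
  steps : ∀ p ∉ (R.cfg 0).crashed, ∀ k, ∃ k' ≥ k, ∃ d, R.ev k' = .step p d
  links : ∀ p ∉ (R.cfg 0).crashed, (∀ k, ∃ k' ≥ k, R.Polls p k') →
    ∀ q c k, (q, p, c) ∈ (R.cfg k).net → ∃ k' ≥ k, R.ev k' = .step p (some (q, c))

end Run

/-- The messages to `p` in a queue. -/
noncomputable def inbox {M : Type*} (l : List (Fin n × Fin n × M)) (p : Fin n) :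
    List (Fin n × Fin n × M) :=
  l.filter (·.2.1 = p)

/-- A process that has not crashed can take a step; if it tries to receive a message then it
receives the oldest message sent to it. -/
theorem exists_step (w : Fin n) (a : Config A) (l : List (Fin n × Fin n × A.Msg)) (hl : a.net = ↑l)
    (p : Fin n) (hp : p ∉ a.crashed) :
    ∃ d b, ∃ l' : List (Fin n × Fin n × A.Msg), Step w a (.step p d) b ∧ b.net = ↑l' ∧
      b.crashed = a.crashed ∧
      (∀ q, inbox l q <+: inbox l' q ∨
        q = p ∧ ∃ x, d = some (x.1, x.2.2) ∧ x.2.1 = p ∧ inbox l p = x :: inbox l' p) ∧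
      ∀ f, A.act p (a.state p) = .recv f → inbox l p ≠ [] →
        ∃ x, d = some (x.1, x.2.2) ∧ x.2.1 = p ∧ inbox l p = x :: inbox l' p := by
  classical
  rcases hI : A.act p (a.state p) with ⟨q, c, s⟩ | k | ⟨i, q, h, k⟩ | ⟨i, h, y, s⟩ | ⟨x, s⟩ | s
  case recv =>
    rcases hb : inbox l p with _ | ⟨x, rest⟩
    · refine ⟨none, { a with state := Function.update a.state p (k none) }, l, ⟨hp, ?_⟩, hl, rfl,
        fun q => Or.inl List.prefix_rfl, by simp⟩
      rw [hI]
      exact Or.inl ⟨rfl, rfl⟩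
    · have hx : x ∈ inbox l p := by simp [hb]
      obtain ⟨hxl, hxp⟩ : x ∈ l ∧ x.2.1 = p := by simpa [inbox] using hx
      -- `erase` removes the first occurrence, which here is the head of the inbox of `p`; it
      -- commutes with filtering by receiver.
      have herase : ∀ q, inbox (l.erase x) q = (inbox l q).erase x := fun q => by
        simp [inbox, List.erase_filter]
      have hin : x :: rest = x :: inbox (l.erase x) p := by rw [herase, hb, List.erase_cons_head]
      refine ⟨some (x.1, x.2.2),
        { a with state := Function.update a.state p (k (some (x.1, x.2.2))), net := ↑(l.erase x) },
        l.erase x, ⟨hp, ?_⟩, rfl, rfl, fun q => ?_, fun f _ _ => ⟨x, rfl, hxp, hin⟩⟩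
      · rw [hI]
        refine Or.inr ⟨x.1, x.2.2, ↑(l.erase x), rfl, ?_, rfl⟩
        rw [hl, ← hxp, Multiset.cons_coe, Multiset.coe_eq_coe]
        exact List.perm_cons_erase hxl
      · rcases eq_or_ne q p with rfl | hq
        · exact Or.inr ⟨rfl, x, rfl, hxp, hin⟩
        · refine Or.inl ?_
          rw [herase, List.erase_of_not_mem]
          simp [inbox, hxp, hq.symm]
  case send =>
    -- New messages go to the end of the list, so older ones keep their positions in every inbox.
    refine ⟨none, { a with state := Function.update a.state p s, net := (p, q, c) ::ₘ a.net },
      l ++ [(p, q, c)], ⟨hp, ?_⟩, ?_, rfl, fun q => Or.inl ?_, by simp⟩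
    · rw [hI]
      exact ⟨rfl, rfl⟩
    · simp only [hl, Multiset.cons_coe, Multiset.coe_eq_coe]
      exact (List.perm_append_singleton _ _).symm
    · simp [inbox]
  case read =>
    refine ⟨none, { a with state := Function.update a.state p (k (a.reg ⟨i, q⟩)) }, l, ⟨hp, ?_⟩,
      hl, rfl, fun q => Or.inl List.prefix_rfl, by simp⟩
    rw [hI]
    exact ⟨rfl, rfl⟩
  case write =>
    refine ⟨none, { a with state := Function.update a.state p s,
                           reg := Function.update a.reg ⟨i, ⟨p, h⟩⟩ y }, l, ⟨hp, ?_⟩,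
      hl, rfl, fun q => Or.inl List.prefix_rfl, by simp⟩
    rw [hI]
    exact ⟨rfl, rfl⟩
  case ret =>
    refine ⟨none, { a with state := Function.update a.state p s,
                           pending := a.pending.erase p }, l, ⟨hp, ?_⟩,
      hl, rfl, fun q => Or.inl List.prefix_rfl, by simp⟩
    rw [hI]
    exact ⟨rfl, rfl⟩
  case tau =>
    refine ⟨none, { a with state := Function.update a.state p s }, l, ⟨hp, ?_⟩,
      hl, rfl, fun q => Or.inl List.prefix_rfl, by simp⟩
    rw [hI]
    exact ⟨rfl, rfl⟩

/-- In every configuration a fair run starts, in which no process crashes or calls an operation. -/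
theorem exists_fair_run (w : Fin n) (a : Config A) :
    ∃ R : Run A w, R.cfg 0 = a ∧ R.Fair ∧ ∀ k, R.ev k = .idle ∨ ∃ p d, R.ev k = .step p d := by
  classical
  -- The network is a multiset and does not know the age of messages; pairing it with an enumeration
  -- provides first-in, first-out delivery.
  let X := {x : Config A × List (Fin n × Fin n × A.Msg) // x.1.net = ↑x.2}
  have hnext : ∀ (x : X) (p : Fin n), ∃ (e : Event n V A.Msg) (y : X), Step w x.1.1 e y.1.1 ∧
      y.1.1.crashed = x.1.1.crashed ∧ (e = .idle ∨ ∃ p d, e = .step p d) ∧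
      (p ∉ x.1.1.crashed → ∃ d, e = .step p d) ∧
      (∀ q, inbox x.1.2 q <+: inbox y.1.2 q ∨
        ∃ z, e = .step q (some (z.1, z.2.2)) ∧ z.2.1 = q ∧ inbox x.1.2 q = z :: inbox y.1.2 q) ∧
      ∀ q d f, e = .step q d → A.act q (x.1.1.state q) = .recv f → inbox x.1.2 q ≠ [] →
        ∃ z, e = .step q (some (z.1, z.2.2)) ∧ z.2.1 = q ∧ inbox x.1.2 q = z :: inbox y.1.2 q := by
    rintro ⟨⟨b, l⟩, hl⟩ p
    by_cases hp : p ∈ b.crashed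
    · exact ⟨.idle, ⟨⟨b, l⟩, hl⟩, rfl, rfl, Or.inl rfl, fun h => absurd hp h,
        fun q => Or.inl List.prefix_rfl, by simp⟩
    · obtain ⟨d, b', l', h1, h2, h3, h4, h5⟩ := exists_step w b l hl p hp
      refine ⟨.step p d, ⟨⟨b', l'⟩, h2⟩, h1, h3, Or.inr ⟨p, d, rfl⟩, fun _ => ⟨d, rfl⟩,
        fun q => ?_, ?_⟩
      · rcases h4 q with h | ⟨rfl, x, rfl, hx⟩
        · exact Or.inl h
        · exact Or.inr ⟨x, rfl, hx⟩
      · rintro q d' f he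
        cases he
        intro hf hne
        obtain ⟨x, rfl, hx⟩ := h5 f hf hne
        exact ⟨x, rfl, hx⟩
  choose e y h1 h2 h3 h4 h5 h6 using hnext
  -- Round robin: time `k * n + p` belongs to process `p`.
  let sched : ℕ → Fin n := fun k => ⟨k % n, Nat.mod_lt _ w.pos⟩
  obtain ⟨l, hl⟩ := Quot.exists_rep a.net
  let s : ℕ → X := fun k => Nat.rec ⟨⟨a, l⟩, hl.symm⟩ (fun k x => y x (sched k)) k
  have hs : ∀ k, s (k + 1) = y (s k) (sched k) := fun k => rfl
  let R : Run A w := ⟨fun k => (s k).1.1, fun k => e (s k) (sched k), fun k => h1 _ _⟩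
  have hcr : ∀ k, (s k).1.1.crashed = a.crashed := by
    intro k
    induction k with
    | zero => rfl
    | succ k ih => rw [hs, h2, ih]
  refine ⟨R, rfl, ⟨fun p hp k => ?_, fun p hp hpoll q c => ?_⟩, fun k => h3 _ _⟩
  · refine ⟨k * n + p, ?_, h4 (s (k * n + p)) p ?_ |>.imp fun d hd => ?_⟩
    · have := Nat.le_mul_of_pos_right k w.pos
      omega
    · rw [hcr]
      exact hp
    · change e _ (sched (k * n + p)) = _
      have : sched (k * n + p) = p := by
        ext
        simp [sched, Nat.mod_eq_of_lt p.2]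
      rw [this]
      exact hd
  -- Induction on the position in the inbox. Between polls with effect the inbox only grows at its
  -- end, and each such poll removes the head, so a message among the first `j + 1` is received or
  -- comes to be among the first `j`.
  · have key : ∀ j k, (q, p, c) ∈ (inbox (s k).1.2 p).take j →
        ∃ k' ≥ k, R.ev k' = .step p (some (q, c)) := by
      intro j
      induction j with
      | zero => simp
      | succ j ihj =>
        intro k hk
        by_contra! hno
        have hcase : ∀ i ≥ k, (q, p, c) ∈ (inbox (s i).1.2 p).take (j + 1) →
            ¬ ∃ z, R.ev i = .step p (some (z.1, z.2.2)) ∧ z.2.1 = p ∧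
              inbox (s i).1.2 p = z :: inbox (s (i + 1)).1.2 p := by
          rintro i hi hm ⟨z, hz, hz', hb⟩
          rw [hb, List.take_succ_cons, List.mem_cons] at hm
          rcases hm with rfl | hm
          · exact hno i hi hz
          · obtain ⟨k', hk', h⟩ := ihj (i + 1) hm
            exact hno k' (by omega) h
        have hall : ∀ i ≥ k, (q, p, c) ∈ (inbox (s i).1.2 p).take (j + 1) := by
          intro i hi
          induction i, hi using Nat.le_induction with
          | base => exact hk
          | succ i hi ih =>
            exact (((h5 (s i) (sched i) p).resolve_right (hcase i hi ih)).take (j + 1)).subset ih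
        obtain ⟨i, hi, ⟨d, hd⟩, f, hf⟩ := hpoll k
        have hne : inbox (s i).1.2 p ≠ [] := by
          intro h
          have := hall i hi
          simp [h] at this
        exact hcase i hi (hall i hi) (h6 (s i) (sched i) p d f hd hf hne)
    intro k hk
    refine key (inbox (s k).1.2 p).length k ?_
    rw [List.take_length]
    have : (q, p, c) ∈ (s k).1.1.net := hk
    rw [(s k).2, Multiset.mem_coe] at this
    simpa [inbox] using this


/-! ### Merging and concatenating runs -/

variable {n m : ℕ} {L : Fin m → Finset (Fin n)} {V : Type u}
  {A : Algorithm.{u, v} L V} {w : Fin n}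

/-- The event is a step of a process in `S` or a call by a process in `S`, or nothing happens. -/
def Event.By {M : Type v} (S : Finset (Fin n)) (e : Event n V M) : Prop :=
  e = .idle ∨ (∃ p ∈ S, ∃ o, e = .invoke p o) ∨ ∃ p ∈ S, ∃ d, e = .step p d

theorem Step.crashed {a b : Config A} {e : Event n V A.Msg} (h : Step w a e b) :
    b.crashed = a.crashed ∨ ∃ p, e = .crash p ∧ b.crashed = insert p a.crashed := by
  rcases e with _ | p | ⟨p, o⟩ | ⟨p, d⟩
  · obtain rfl := h
    exact Or.inl rfl
  · obtain rfl := h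
    exact Or.inr ⟨p, rfl, rfl⟩
  · obtain ⟨-, -, -, rfl⟩ := h
    exact Or.inl rfl
  · left
    obtain ⟨-, h⟩ := h
    rcases hI : A.act p (a.state p) with ⟨q, c, s⟩ | k | ⟨i, q, hi, k⟩ | ⟨i, hi, y, s⟩ | ⟨x, s⟩ | s <;>
      rw [hI] at h
    case recv => rcases h with ⟨-, rfl⟩ | ⟨q, c, net', -, -, rfl⟩ <;> rfl
    all_goals
      obtain ⟨-, rfl⟩ := h
      rfl

/-- Only the owner of a register changes it. -/
theorem Step.reg_eq {a b : Config A} {e : Event n V A.Msg} (h : Step w a e b) {ρ : Reg L}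
    (hρ : ∀ d, e ≠ .step ρ.2 d) : b.reg ρ = a.reg ρ := by
  rcases e with _ | p | ⟨p, o⟩ | ⟨p, d⟩
  · obtain rfl := h
    rfl
  · obtain rfl := h
    rfl
  · obtain ⟨-, -, -, rfl⟩ := h
    rfl
  · obtain ⟨-, h⟩ := h
    rcases hI : A.act p (a.state p) with ⟨q, c, s⟩ | k | ⟨i, q, hi, k⟩ | ⟨i, hi, y, s⟩ | ⟨x, s⟩ | s <;>
      rw [hI] at h
    case recv => rcases h with ⟨-, rfl⟩ | ⟨q, c, net', -, -, rfl⟩ <;> rfl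
    case write =>
      obtain ⟨-, rfl⟩ := h
      refine Function.update_of_ne ?_ _ _
      rintro rfl
      exact hρ d rfl
    all_goals
      obtain ⟨-, rfl⟩ := h
      rfl

/-- A message stays in the network until it is received. -/
theorem Step.mem_net {a b : Config A} {e : Event n V A.Msg} (h : Step w a e b) {p q : Fin n}
    {c : A.Msg} (hm : (q, p, c) ∈ a.net) : (q, p, c) ∈ b.net ∨ e = .step p (some (q, c)) := by
  rcases e with _ | p' | ⟨p', o⟩ | ⟨p', d⟩
  · obtain rfl := h
    exact Or.inl hm
  · obtain rfl := h
    exact Or.inl hm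
  · obtain ⟨-, -, -, rfl⟩ := h
    exact Or.inl hm
  · obtain ⟨-, h⟩ := h
    rcases hI : A.act p' (a.state p') with ⟨q', c', s⟩ | k | ⟨i, q', hi, k⟩ | ⟨i, hi, y, s⟩ | ⟨x, s⟩ | s
      <;> rw [hI] at h
    case recv =>
      rcases h with ⟨-, rfl⟩ | ⟨q', c', net', rfl, hn, rfl⟩
      · exact Or.inl hm
      · rw [hn, Multiset.mem_cons] at hm
        rcases hm with hm | hm
        · cases hm
          exact Or.inr rfl
        · exact Or.inl hm
    case send =>
      obtain ⟨-, rfl⟩ := h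
      exact Or.inl (Multiset.mem_cons_of_mem hm)
    all_goals
      obtain ⟨-, rfl⟩ := h
      exact Or.inl hm

/-- The processes in `S` are as in `b`, all others as in `c`; messages in both networks are in
transit. -/
def Config.merge (c : Config A) (S : Finset (Fin n)) (b : Config A) : Config A where
  state p := if p ∈ S then b.state p else c.state p
  net := c.net + b.net
  reg ρ := if (ρ.2 : Fin n) ∈ S then b.reg ρ else c.reg ρ
  pending := c.pending ∪ b.pending
  crashed := c.crashed

theorem merge_state_update (c b : Config A) {S : Finset (Fin n)} {p : Fin n} (hp : p ∈ S)
    (s : A.State) : (fun q => if q ∈ S then Function.update b.state p s q else c.state q) =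
      Function.update (c.merge S b).state p s := by
  funext q
  rcases eq_or_ne q p with rfl | hq
  · simp [hp]
  · simp [Function.update_of_ne hq, Config.merge]

/-- A process in `S` depends only on its own state, on messages, and on registers that it can read.
The state is that of `b`, the messages of `b` are all present, and registers read from outside `S`
agree by `hreg`. The messages of `c` simply stay in transit. Since `merge` takes `crashed` from `c`,
processes that are crashed in `b` may be alive in the merge. -/
theorem Step.merge {c b b' : Config A} {S : Finset (Fin n)} {e : Event n V A.Msg}
    (h : Step w b e b') (he : e.By S) (hcr : ∀ p ∈ S, p ∉ c.crashed) (hpd : ∀ p ∈ S, p ∉ c.pending)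
    (hreg : ∀ i, (∃ p ∈ S, p ∈ L i) → ∀ q : {q // q ∈ L i}, (q : Fin n) ∉ S →
      c.reg ⟨i, q⟩ = b.reg ⟨i, q⟩) :
    Step w (c.merge S b) e (c.merge S b') := by
  rcases he with rfl | ⟨p, hp, o, rfl⟩ | ⟨p, hp, d, rfl⟩
  · obtain rfl := h
    rfl
  · obtain ⟨h1, h2, h3, rfl⟩ := h
    refine ⟨hcr p hp, ?_, h3, ?_⟩
    · simp [Config.merge, hpd p hp, h2]
    · simp only [Config.merge, merge_state_update c b hp]
      simp [hp]
  · have hst : (c.merge S b).state p = b.state p := if_pos hp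
    have hpe : c.pending ∪ b.pending.erase p = (c.pending ∪ b.pending).erase p := by
      rw [Finset.erase_union_distrib, Finset.erase_eq_of_notMem (hpd p hp)]
    obtain ⟨-, h⟩ := h
    refine ⟨hcr p hp, ?_⟩
    rw [hst]
    rcases hI : A.act p (b.state p) with ⟨q, x, s⟩ | k | ⟨i, q, hi, k⟩ | ⟨i, hi, y, s⟩ | ⟨x, s⟩ | s <;>
      rw [hI] at h
    case recv =>
      rcases h with ⟨rfl, rfl⟩ | ⟨q, x, net', rfl, hn, rfl⟩
      · refine Or.inl ⟨rfl, ?_⟩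
        simp only [Config.merge, merge_state_update c b hp]
      · refine Or.inr ⟨q, x, c.net + net', rfl, ?_, ?_⟩
        · simp [Config.merge, hn]
        · simp only [Config.merge, merge_state_update c b hp]
    case read =>
      obtain ⟨rfl, rfl⟩ := h
      refine ⟨rfl, ?_⟩
      have : (c.merge S b).reg ⟨i, q⟩ = b.reg ⟨i, q⟩ := by
        by_cases hq : (q : Fin n) ∈ S
        · exact if_pos hq
        · exact (if_neg hq).trans (hreg i ⟨p, hp, hi⟩ q hq)
      rw [this]
      simp only [Config.merge, merge_state_update c b hp]
    case write =>
      obtain ⟨rfl, rfl⟩ := h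
      refine ⟨rfl, ?_⟩
      have : (fun ρ : Reg L => if (ρ.2 : Fin n) ∈ S then
          Function.update b.reg ⟨i, ⟨p, hi⟩⟩ y ρ else c.reg ρ) =
          Function.update (c.merge S b).reg ⟨i, ⟨p, hi⟩⟩ y := by
        funext ρ
        rcases eq_or_ne ρ ⟨i, ⟨p, hi⟩⟩ with rfl | hq
        · simp [hp]
        · simp [Function.update_of_ne hq, Config.merge]
      simp only [Config.merge, merge_state_update c b hp] at this ⊢
      rw [this]
    case send =>
      obtain ⟨rfl, rfl⟩ := h
      refine ⟨rfl, ?_⟩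
      simp only [Config.merge, merge_state_update c b hp, Multiset.add_cons]
    case ret =>
      obtain ⟨rfl, rfl⟩ := h
      refine ⟨rfl, ?_⟩
      simp only [Config.merge, merge_state_update c b hp, hpe]
    case tau =>
      obtain ⟨rfl, rfl⟩ := h
      refine ⟨rfl, ?_⟩
      simp only [Config.merge, merge_state_update c b hp]

/-- The starting configuration, except that the processes in `F` have crashed. -/
def Config.startCrashed (A : Algorithm.{u, v} L V) (F : Finset (Fin n)) : Config A :=
  { Config.start A with crashed := F }

/-- A configuration in which the processes in `S` have not taken a step. -/
structure Config.Untouched (c : Config A) (S : Finset (Fin n)) : Prop where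
  state : ∀ p ∈ S, c.state p = A.start p
  reg : ∀ ρ : Reg L, (ρ.2 : Fin n) ∈ S → c.reg ρ = A.regStart ρ
  pending : ∀ p ∈ S, p ∉ c.pending
  crashed : ∀ p ∈ S, p ∉ c.crashed

/-- Lets the merge of a solo run of `S` begin exactly in `c`, so that it can be appended to a run
that leads to `c`. -/
theorem Config.Untouched.merge_startCrashed {c : Config A} {S F : Finset (Fin n)}
    (h : c.Untouched S) : c.merge S (Config.startCrashed A F) = c := by
  obtain ⟨st, net, reg, pd, cr⟩ := c
  obtain ⟨h1, h2, -, -⟩ := h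
  simp only [Config.merge, Config.startCrashed, Config.start, Config.mk.injEq, add_zero,
    Finset.union_empty, and_true, true_and]
  constructor
  · funext p
    split_ifs with hp
    · exact (h1 p hp).symm
    · rfl
  · funext ρ
    split_ifs with hp
    · exact (h2 ρ hp).symm
    · rfl

namespace Run

def Returns (R : Run A w) (p : Fin n) (x : V) (e : ℕ) : Prop :=
  (∃ d, R.ev e = .step p d) ∧ ∃ s, A.act p ((R.cfg e).state p) = .ret x s

/-- The operation `f` of `p` that starts at time `o` completes at time `e` with response `x`. -/
structure Completes (R : Run A w) (p : Fin n) (f : Op V) (o e : ℕ) (x : V) : Prop where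
  invoke : R.ev o = .invoke p f
  lt : o < e
  returns : R.Returns p x e
  first : ∀ k, o < k → k < e → ∀ y, ¬ R.Returns p y k

/-- First `R` until time `N`, then `R'`. -/
def append (R : Run A w) (N : ℕ) (R' : Run A w) (h : R'.cfg 0 = R.cfg N) : Run A w where
  cfg k := if k < N then R.cfg k else R'.cfg (k - N)
  ev k := if k < N then R.ev k else R'.ev (k - N)
  cfg_succ k := by
    rcases lt_trichotomy (k + 1) N with hk | rfl | hk
    · rw [if_pos (by omega), if_pos (by omega), if_pos hk]
      exact R.cfg_succ k
    · rw [if_pos (by omega), if_pos (by omega), if_neg (by omega), Nat.sub_self, h]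
      exact R.cfg_succ k
    · rw [if_neg (by omega), if_neg (by omega), if_neg (by omega), show k + 1 - N = k - N + 1 by omega]
      exact R'.cfg_succ _

variable {R R' : Run A w} {N : ℕ} {h : R'.cfg 0 = R.cfg N}

theorem append_ev_lt {k : ℕ} (hk : k < N) : (R.append N R' h).ev k = R.ev k := if_pos hk

theorem append_ev_add (k : ℕ) : (R.append N R' h).ev (N + k) = R'.ev k := by
  simp [append]

theorem append_cfg_lt {k : ℕ} (hk : k < N) : (R.append N R' h).cfg k = R.cfg k := if_pos hk

theorem append_cfg_add (k : ℕ) : (R.append N R' h).cfg (N + k) = R'.cfg k := by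
  simp [append]

theorem append_returns_lt {k : ℕ} (hk : k < N) {p x} :
    (R.append N R' h).Returns p x k ↔ R.Returns p x k := by
  rw [Returns, append_ev_lt hk, append_cfg_lt hk]
  rfl

theorem append_returns_add {k : ℕ} {p x} :
    (R.append N R' h).Returns p x (N + k) ↔ R'.Returns p x k := by
  rw [Returns, append_ev_add, append_cfg_add]
  rfl

theorem Completes.append_left {p f o e x} (hc : R.Completes p f o e x) (he : e < N) :
    (R.append N R' h).Completes p f o e x where
  invoke := (append_ev_lt (hc.lt.trans he)).trans hc.invoke
  lt := hc.lt
  returns := (append_returns_lt he).2 hc.returns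
  first k hk hk' y hy := hc.first k hk hk' y ((append_returns_lt (by omega)).1 hy)

theorem append_completes_add {p f o e x} :
    (R.append N R' h).Completes p f (N + o) (N + e) x ↔ R'.Completes p f o e x where
  mp hc :=
    ⟨(append_ev_add o).symm.trans hc.invoke, by have := hc.lt; omega,
      append_returns_add.1 hc.returns,
      fun k hk hk' y hy => hc.first (N + k) (by omega) (by omega) y (append_returns_add.2 hy)⟩
  mpr hc :=
    ⟨(append_ev_add o).trans hc.invoke, by have := hc.lt; omega,
      append_returns_add.2 hc.returns, fun k hk hk' y hy => by
        obtain ⟨j, rfl⟩ := Nat.exists_eq_add_of_le (show N ≤ k by omega)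
        exact hc.first j (by omega) (by omega) y (append_returns_add.1 hy)⟩

/-- First one transition, then `R`. -/
def cons (a : Config A) (e : Event n V A.Msg) (R : Run A w) (h : Step w a e (R.cfg 0)) : Run A w where
  cfg k := Nat.casesOn k a R.cfg
  ev k := Nat.casesOn k e R.ev
  cfg_succ k := by
    cases k with
    | zero => exact h
    | succ k => exact R.cfg_succ k

/-- In the starting configuration, the processes in `F` crash one after the other until time `n`. -/
def crashing (A : Algorithm.{u, v} L V) (w : Fin n) (F : Finset (Fin n)) : Run A w where
  cfg k := Config.startCrashed A (F.filter fun p => p.val < k)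
  ev k := if h : k < n then if ⟨k, h⟩ ∈ F then .crash ⟨k, h⟩ else .idle else .idle
  cfg_succ k := by
    split_ifs with h1 h2
    · refine congrArg (Config.startCrashed A) ?_
      ext p
      change p ∈ F.filter (fun p => p.val < k + 1) ↔
        p ∈ insert ⟨k, h1⟩ (F.filter fun p => p.val < k)
      simp only [Finset.mem_filter, Finset.mem_insert, Fin.ext_iff]
      constructor
      · rintro ⟨hp, hk⟩
        rcases Nat.lt_succ_iff_lt_or_eq.1 hk with hk | hk
        · exact Or.inr ⟨hp, hk⟩
        · exact Or.inl hk
      · rintro (hk | ⟨hp, hk⟩)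
        · obtain rfl : p = ⟨k, h1⟩ := Fin.ext hk
          exact ⟨h2, by simp⟩
        · exact ⟨hp, by omega⟩
    all_goals
      refine congrArg (Config.startCrashed A) (Finset.filter_congr fun p hp => ?_)
      have : p.val ≠ k := by
        rintro rfl
        simp_all
      omega

theorem crashing_cfg_zero (F : Finset (Fin n)) : (crashing A w F).cfg 0 = Config.start A := by
  simp [crashing, Config.startCrashed, Config.start]

theorem crashing_cfg_card (F : Finset (Fin n)) :
    (crashing A w F).cfg n = Config.startCrashed A F := by
  simp [crashing]

theorem crashing_ev (F : Finset (Fin n)) (k : ℕ) :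
    (crashing A w F).ev k = .idle ∨ ∃ p ∈ F, (crashing A w F).ev k = .crash p := by
  simp only [crashing]
  split_ifs with h1 h2
  · exact Or.inr ⟨_, h2, rfl⟩
  all_goals exact Or.inl rfl

/-- The merge of a run of the processes in `S` into a configuration. -/
def merge (c : Config A) (S : Finset (Fin n)) (R : Run A w) (hev : ∀ k, (R.ev k).By S)
    (hcr : ∀ p ∈ S, p ∉ c.crashed) (hpd : ∀ p ∈ S, p ∉ c.pending)
    (hreg : ∀ i, (∃ p ∈ S, p ∈ L i) → ∀ q : {q // q ∈ L i}, (q : Fin n) ∉ S →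
      c.reg ⟨i, q⟩ = (R.cfg 0).reg ⟨i, q⟩) : Run A w where
  cfg k := c.merge S (R.cfg k)
  ev := R.ev
  cfg_succ k := by
    refine (R.cfg_succ k).merge (hev k) hcr hpd fun i hi q hq => ?_
    -- Agreement at time `0` is enough: in `R` only processes of `S` take steps, so registers owned
    -- outside `S` keep their contents.
    rw [hreg i hi q hq]
    clear hcr hpd hreg
    induction k with
    | zero => rfl
    | succ k ih =>
      rw [ih, (R.cfg_succ k).reg_eq]
      intro d hd
      rcases hev k with h | ⟨p, hp, o, h⟩ | ⟨p, hp, d', h⟩ <;> rw [hd] at h <;> cases h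
      exact hq hp

theorem merge_completes {c : Config A} {S : Finset (Fin n)} {R : Run A w} {h1 h2 h3 h4} {p f o e x}
    (hp : p ∈ S) (hc : R.Completes p f o e x) :
    (merge c S R h1 h2 h3 h4).Completes p f o e x := by
  have hret : ∀ y k, (merge c S R h1 h2 h3 h4).Returns p y k ↔ R.Returns p y k := by
    intro y k
    have : ((merge c S R h1 h2 h3 h4).cfg k).state p = (R.cfg k).state p := if_pos hp
    rw [Returns, this]
    rfl
  exact ⟨hc.invoke, hc.lt, (hret _ _).2 hc.returns, fun k hk hk' y hy =>
    hc.first k hk hk' y ((hret _ _).1 hy)⟩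

def toExecution (R : Run A w) (h : R.cfg 0 = Config.start A) : Execution A w :=
  ⟨R.cfg, R.ev, h, R.cfg_succ⟩

end Run

namespace Execution

theorem mem_faulty_of_mem_crashed {E : Execution A w} {p : Fin n} {k : ℕ} (h : p ∈ (E.cfg k).crashed) :
    p ∈ E.faulty := by
  induction k with
  | zero =>
    rw [E.cfg_zero] at h
    simp [Config.start] at h
  | succ k ih =>
    rcases (E.cfg_succ k).crashed with h' | ⟨q, hq, h'⟩
    · exact ih (h' ▸ h)
    · rw [h', Finset.mem_insert] at h
      rcases h with rfl | h
      · exact ⟨k, hq⟩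
      · exact ih h

/-- Fairness concerns the infinite future only. A message that was sent before `N` and is never
received is still in the network at the start of the tail, and the tail delivers it. -/
theorem fair_of_tail {E : Execution A w} {R : Run A w} (hR : R.Fair) (N : ℕ)
    (hcfg : ∀ k, E.cfg (N + k) = R.cfg k) (hev : ∀ k, E.ev (N + k) = R.ev k) : E.Fair := by
  have hcr : ∀ p ∉ E.faulty, p ∉ (R.cfg 0).crashed := fun p hp h => hp (by
    rw [← hcfg] at h
    exact mem_faulty_of_mem_crashed h)
  refine ⟨fun p hp k => ?_, fun p hp hpoll q c k hm => ?_⟩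
  · obtain ⟨k', hk', d, hd⟩ := hR.steps p (hcr p hp) k
    exact ⟨N + k', by omega, d, (hev k').trans hd⟩
  · by_contra! hno
    have hmem : ∀ k' ≥ k, (q, p, c) ∈ (E.cfg k').net := by
      intro k' hk'
      induction k', hk' using Nat.le_induction with
      | base => exact hm
      | succ k' hk' ih => exact ((E.cfg_succ k').mem_net ih).resolve_right (hno k' hk')
    have hm' := hmem (N + k) (by omega)
    rw [hcfg] at hm'
    have hpoll' : ∀ j, ∃ i ≥ j, R.Polls p i := fun j => by
      obtain ⟨j', hj', h1, h2⟩ := hpoll (N + j)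
      obtain ⟨i, rfl⟩ := Nat.exists_eq_add_of_le (show N ≤ j' by omega)
      rw [hev] at h1
      rw [hcfg] at h2
      exact ⟨i, by omega, h1, h2⟩
    obtain ⟨k', hk', h⟩ := hR.links p (hcr p hp) hpoll' q c k hm'
    exact hno (N + k') (by omega) ((hev k').trans h)

end Execution


/-! ### Impossibility beyond `t_L` crashes -/

variable {n m : ℕ} {L : Fin m → Finset (Fin n)} {V : Type u}
  {A : Algorithm.{u, v} L V} {w : Fin n}

theorem Step.pending {a b : Config A} {e : Event n V A.Msg} (h : Step w a e b) {p : Fin n}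
    (hp : p ∈ b.pending) : p ∈ a.pending ∨ ∃ o, e = .invoke p o := by
  rcases e with _ | q | ⟨q, o⟩ | ⟨q, d⟩
  · obtain rfl := h
    exact Or.inl hp
  · obtain rfl := h
    exact Or.inl hp
  · obtain ⟨-, -, -, rfl⟩ := h
    rcases Finset.mem_insert.1 hp with rfl | hp
    · exact Or.inr ⟨o, rfl⟩
    · exact Or.inl hp
  · left
    obtain ⟨-, h⟩ := h
    rcases hI : A.act q (a.state q) with ⟨q', c, s⟩ | k | ⟨i, q', hi, k⟩ | ⟨i, hi, y, s⟩ | ⟨x, s⟩ | s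
      <;> rw [hI] at h
    case recv => rcases h with ⟨-, rfl⟩ | ⟨q, c, net', -, -, rfl⟩ <;> exact hp
    case ret =>
      obtain ⟨-, rfl⟩ := h
      exact Finset.mem_of_mem_erase hp
    all_goals
      obtain ⟨-, rfl⟩ := h
      exact hp

theorem Run.append_ev_cases (R : Run A w) (N : ℕ) (R' : Run A w) (h) (k : ℕ) :
    (k < N ∧ (R.append N R' h).ev k = R.ev k) ∨
      ∃ j, k = N + j ∧ (R.append N R' h).ev k = R'.ev j := by
  rcases lt_or_ge k N with hk | hk
  · exact Or.inl ⟨hk, append_ev_lt hk⟩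
  · obtain ⟨j, rfl⟩ := Nat.exists_eq_add_of_le hk
    exact Or.inr ⟨j, rfl, append_ev_add j⟩

theorem Run.pending_subset {R : Run A w} {S : Finset (Fin n)} (hev : ∀ k, (R.ev k).By S)
    (h0 : (R.cfg 0).pending ⊆ S) (k : ℕ) : (R.cfg k).pending ⊆ S := by
  induction k with
  | zero => exact h0
  | succ k ih =>
    intro p hp
    rcases (R.cfg_succ k).pending hp with h | ⟨o, h⟩
    · exact ih h
    · rcases hev k with h' | ⟨q, hq, o', h'⟩ | ⟨q, hq, d, h'⟩ <;> rw [h] at h' <;> cases h'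
      exact hq

/-- If the processes outside `S` crash at the beginning, then an operation of a process in `S`
completes. -/
theorem exists_solo_run {v₀ : V} {t : ℕ} (hA : Implements A w v₀ t) {S : Finset (Fin n)}
    (hS : Sᶜ.card ≤ t) {p : Fin n} (hp : p ∈ S) (f : Op V)
    (hf : ∀ x, f = .write x → p = w ∧ x ≠ v₀) :
    ∃ (R : Run A w) (N : ℕ) (y : V), R.cfg 0 = Config.startCrashed A Sᶜ ∧
      (∀ k, (R.ev k).By S) ∧ (∀ k q o, R.ev k = .invoke q o → k = 0) ∧
      R.Completes p f 0 N y ∧ (f = .read → y = v₀) := by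
  have hstep : Step w (Config.startCrashed A Sᶜ) (.invoke p f)
      { Config.startCrashed A Sᶜ with
        state := Function.update A.start p (A.invoke p f (A.start p))
        pending := insert p ∅ } := by
    refine ⟨?_, Finset.notMem_empty p, fun x hx => (hf x hx).1, rfl⟩
    change p ∉ Sᶜ
    simpa using hp
  obtain ⟨T, hT0, hTf, hT⟩ := exists_fair_run w
    { Config.startCrashed A Sᶜ with
      state := Function.update A.start p (A.invoke p f (A.start p))
      pending := insert p ∅ }
  rw [← hT0] at hstep
  let R := Run.cons _ _ T hstep
  have hTcr : ∀ k, (T.cfg k).crashed = Sᶜ := by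
    intro k
    induction k with
    | zero => rw [hT0]; rfl
    | succ k ih =>
      rcases (T.cfg_succ k).crashed with h | ⟨q, hq, -⟩
      · rw [h, ih]
      · rcases hT k with h | ⟨p, d, h⟩ <;> rw [hq] at h <;> cases h
  have hby : ∀ k, (R.ev k).By S := by
    rintro (_ | k)
    · exact Or.inr (Or.inl ⟨p, hp, f, rfl⟩)
    · rcases hT k with h | ⟨q, d, h⟩
      · exact Or.inl h
      · refine Or.inr (Or.inr ⟨q, ?_, d, h⟩)
        have := T.cfg_succ k
        rw [h] at this
        have := this.1
        rw [hTcr] at this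
        simpa using this
  have hinv : ∀ k q o, R.ev k = .invoke q o → k = 0 := by
    rintro (_ | k) q o h
    · rfl
    · rcases hT k with h' | ⟨q, d, h'⟩ <;> cases h.symm.trans h'
  have hglue : R.cfg 0 = (Run.crashing A w Sᶜ).cfg n := (Run.crashing_cfg_card _).symm
  -- `Implements` speaks of executions from the starting configuration, so the crashes are put in
  -- front; they end before time `n`, when `f` is called.
  let G := (Run.crashing A w Sᶜ).append n R hglue
  have hG0 : G.cfg 0 = Config.start A :=
    (Run.append_cfg_lt w.pos).trans (Run.crashing_cfg_zero _)
  let E := G.toExecution hG0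
  -- The fair part `T` begins at `n + 1`, after the crashes and the call.
  have hfair : E.Fair := Execution.fair_of_tail hTf (n + 1)
    (fun k => by
      rw [add_assoc, add_comm 1 k]
      exact Run.append_cfg_add (R := Run.crashing A w Sᶜ) (h := hglue) (k + 1))
    (fun k => by
      rw [add_assoc, add_comm 1 k]
      exact Run.append_ev_add (R := Run.crashing A w Sᶜ) (h := hglue) (k + 1))
  have hcases := Run.append_ev_cases (Run.crashing A w Sᶜ) n R hglue
  have hfaulty : E.faulty ⊆ (Sᶜ : Finset (Fin n)) := by
    rintro q ⟨k, hk⟩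
    rcases hcases k with ⟨-, h⟩ | ⟨j, -, h⟩ <;> have h := h.symm.trans hk
    · rcases Run.crashing_ev (A := A) (w := w) Sᶜ k with h' | ⟨q', hq', h'⟩ <;> cases h'.symm.trans h
      exact hq'
    · rcases hby j with h' | ⟨q, hq, o', h'⟩ | ⟨q, hq, d, h'⟩ <;> cases h'.symm.trans h
  have hinvE : ∀ k q o, E.ev k = .invoke q o → k = n ∧ q = p ∧ o = f := by
    intro k q o hk
    rcases hcases k with ⟨-, h⟩ | ⟨j, rfl, h⟩ <;> have h := h.symm.trans hk
    · rcases Run.crashing_ev (A := A) (w := w) Sᶜ k with h' | ⟨q', hq', h'⟩ <;> cases h'.symm.trans h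
    · obtain rfl := hinv j q o h
      cases h
      exact ⟨rfl, rfl, rfl⟩
  have hdist : E.DistinctWrites v₀ := by
    refine ⟨?_, ?_⟩
    · rintro o x ⟨q, h⟩
      exact (hf x (hinvE o q _ h).2.2.symm).2
    · rintro o o' x ⟨q, h⟩ ⟨q', h'⟩
      exact (hinvE o q _ h).1.trans (hinvE o' q' _ h').1.symm
  have hcard : E.faulty.ncard ≤ t := by
    refine (Set.ncard_le_ncard hfaulty).trans ?_
    rwa [Set.ncard_coe_finset]
  obtain ⟨h1, h2, -⟩ := hA E hfair hcard hdist
  have hevn : E.ev n = .invoke p f := Run.append_ev_add (R := Run.crashing A w Sᶜ) (h := hglue) 0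
  obtain ⟨e, y, hc⟩ := h1 n p f hevn fun h => by simpa [hp] using hfaulty h
  obtain ⟨p', f', h3, h4, h5, h6⟩ := id hc
  obtain ⟨-, rfl, rfl⟩ := hinvE _ _ _ h3
  obtain ⟨N, rfl⟩ := Nat.exists_eq_add_of_le h4.le
  refine ⟨R, N, y, rfl, hby, hinv, ?_, ?_⟩
  · have : G.Completes p' f' (n + 0) (n + N) y := ⟨h3, h4, h5, h6⟩
    exact Run.append_completes_add.1 this
  · rintro rfl
    have hno : ∀ o x, ¬ E.IsWrite o x := by
      rintro o x ⟨q, h⟩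
      cases (hinvE o q _ h).2.2
    rcases h2 n y ⟨⟨p', hevn⟩, n + N, hc⟩ with ⟨o, ho, -⟩ | ⟨-, h⟩
    · exact absurd ho (hno o y)
    · exact h

/-- If two sets of processes do not share registers and either may be the set of the correct
processes, then a reader in one set can miss a value written by a process in the other. -/
theorem not_implements_of_separated {v₀ v₁ : V} {t : ℕ} (hv : v₁ ≠ v₀) {P P' : Finset (Fin n)}
    (hdisj : Disjoint P P') (hsep : ∀ i, ∀ p₁ ∈ P, ∀ p₂ ∈ P', p₁ ∈ L i → p₂ ∉ L i)
    (hP : Pᶜ.card ≤ t) (hP' : P'ᶜ.card ≤ t) (hw : w ∈ P) {r : Fin n} (hr : r ∈ P') :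
    ¬ Implements A w v₀ t := by
  intro hA
  obtain ⟨R₁, N₁, y₁, h10, h1by, h1inv, h1c, -⟩ := exists_solo_run hA hP hw (.write v₁)
    (by rintro x ⟨⟩; exact ⟨rfl, hv⟩)
  obtain ⟨R₂, N₂, y₂, h20, h2by, h2inv, h2c, hy⟩ := exists_solo_run hA hP' hr .read (by simp)
  -- The solo read returns the starting value, which is called `y₂` from here on.
  obtain rfl := hy rfl
  -- In the combined execution only `Z` crashes, so both `P` and `P'` consist of correct processes.
  set Z := (P ∪ P')ᶜ with hZ
  set c₁ := Config.startCrashed A Z with hc₁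
  have hZP : ∀ p ∈ P, p ∉ Z := fun p hp => by simp [hZ, hp]
  have hZP' : ∀ p ∈ P', p ∉ Z := fun p hp => by simp [hZ, hp]
  have hnot : ∀ p ∈ P', p ∉ P := fun p hp hp' => Finset.disjoint_left.1 hdisj hp' hp
  have hu₁ : c₁.Untouched P := ⟨fun _ _ => rfl, fun _ _ => rfl, fun _ _ => Finset.notMem_empty _, hZP⟩
  let M₁ := Run.merge c₁ P R₁ h1by hu₁.crashed hu₁.pending fun i _ q _ => by rw [h10]; rfl
  have hM₁ : M₁.cfg 0 = c₁ := by
    change c₁.merge P (R₁.cfg 0) = c₁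
    rw [h10, hu₁.merge_startCrashed]
  -- The write returns by the event at time `N₁`, so `N₁ + 1` is the first configuration after it.
  set c₂ := M₁.cfg (N₁ + 1) with hc₂
  have hu₂ : c₂.Untouched P' := by
    refine ⟨fun p hp => if_neg (hnot p hp), fun ρ hρ => if_neg (hnot _ hρ), fun p hp h => ?_, hZP'⟩
    rcases Finset.mem_union.1 h with h | h
    · exact Finset.notMem_empty _ h
    · refine hnot p hp (Run.pending_subset h1by ?_ (N₁ + 1) h)
      rw [h10]
      exact Finset.empty_subset _
  -- Separation enters here: registers readable from `P'` are owned outside `P`, so after the write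
  -- they still have their starting contents.
  let M₂ := Run.merge c₂ P' R₂ h2by hu₂.crashed hu₂.pending fun i ⟨p, hp, hpi⟩ q hq => by
    rw [h20]
    exact if_neg fun hqP => hsep i q hqP p hp q.2 hpi
  have hM₂ : M₂.cfg 0 = c₂ := by
    change c₂.merge P' (R₂.cfg 0) = c₂
    rw [h20, hu₂.merge_startCrashed]
  -- Fairness is restored after the read has returned: delayed messages are delivered only now, and
  -- no operation is called any more.
  obtain ⟨T, hT0, hTf, hT⟩ := exists_fair_run w (M₂.cfg (N₂ + 1))
  let G₂ := M₂.append (N₂ + 1) T hT0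
  have hG₂ : G₂.cfg 0 = M₁.cfg (N₁ + 1) := (Run.append_cfg_lt (Nat.succ_pos _)).trans hM₂
  let G₁ := M₁.append (N₁ + 1) G₂ hG₂
  have hG₁ : G₁.cfg 0 = (Run.crashing A w Z).cfg n := by
    rw [Run.crashing_cfg_card]
    exact (Run.append_cfg_lt (Nat.succ_pos _)).trans hM₁
  let G := (Run.crashing A w Z).append n G₁ hG₁
  let E := G.toExecution ((Run.append_cfg_lt w.pos).trans (Run.crashing_cfg_zero _))
  have hcases : ∀ k, (∃ j, E.ev k = (Run.crashing A w Z).ev j) ∨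
      (∃ j, k = n + j ∧ E.ev k = R₁.ev j) ∨
      (∃ j, k = n + (N₁ + 1 + j) ∧ E.ev k = R₂.ev j) ∨ ∃ j, E.ev k = T.ev j := by
    intro k
    rcases Run.append_ev_cases (Run.crashing A w Z) n G₁ hG₁ k with ⟨-, h⟩ | ⟨j, rfl, h⟩
    · exact Or.inl ⟨_, h⟩
    rcases Run.append_ev_cases M₁ (N₁ + 1) G₂ hG₂ j with ⟨-, h'⟩ | ⟨j, rfl, h'⟩
    · exact Or.inr (Or.inl ⟨_, rfl, h.trans h'⟩)
    rcases Run.append_ev_cases M₂ (N₂ + 1) T hT0 j with ⟨-, h''⟩ | ⟨j, rfl, h''⟩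
    · exact Or.inr (Or.inr (Or.inl ⟨_, rfl, h.trans (h'.trans h'')⟩))
    · exact Or.inr (Or.inr (Or.inr ⟨_, h.trans (h'.trans h'')⟩))
  have hfair : E.Fair := Execution.fair_of_tail hTf (n + (N₁ + 1 + (N₂ + 1)))
    (fun k => by
      rw [add_assoc, add_assoc]
      exact (Run.append_cfg_add (h := hG₁) _).trans
        ((Run.append_cfg_add (h := hG₂) _).trans (Run.append_cfg_add (h := hT0) _)))
    (fun k => by
      rw [add_assoc, add_assoc]
      exact (Run.append_ev_add (h := hG₁) _).trans
        ((Run.append_ev_add (h := hG₂) _).trans (Run.append_ev_add (h := hT0) _)))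
  have hcard : E.faulty.ncard ≤ t := by
    have hsub : E.faulty ⊆ (Z : Set (Fin n)) := by
      rintro q ⟨k, hk⟩
      rcases hcases k with ⟨j, h⟩ | ⟨j, -, h⟩ | ⟨j, -, h⟩ | ⟨j, h⟩ <;> have h := h.symm.trans hk
      · rcases Run.crashing_ev (A := A) (w := w) Z j with h' | ⟨q', hq', h'⟩ <;>
          cases h'.symm.trans h
        exact hq'
      · rcases h1by j with h' | ⟨q, hq, o', h'⟩ | ⟨q, hq, d, h'⟩ <;> cases h'.symm.trans h
      · rcases h2by j with h' | ⟨q, hq, o', h'⟩ | ⟨q, hq, d, h'⟩ <;> cases h'.symm.trans h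
      · rcases hT j with h' | ⟨q, d, h'⟩ <;> cases h'.symm.trans h
    refine (Set.ncard_le_ncard hsub).trans ?_
    rw [Set.ncard_coe_finset]
    exact (Finset.card_le_card (Finset.compl_subset_compl.2 Finset.subset_union_left)).trans hP
  have hwrite : ∀ o x, E.IsWrite o x → o = n ∧ x = v₁ := by
    rintro o x ⟨q, hq⟩
    rcases hcases o with ⟨j, h⟩ | ⟨j, rfl, h⟩ | ⟨j, -, h⟩ | ⟨j, h⟩ <;> have h := h.symm.trans hq
    · rcases Run.crashing_ev (A := A) (w := w) Z j with h' | ⟨q', hq', h'⟩ <;>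
        cases h'.symm.trans h
    · obtain rfl := h1inv j _ _ h
      cases h1c.invoke.symm.trans h
      exact ⟨rfl, rfl⟩
    · obtain rfl := h2inv j _ _ h
      cases h2c.invoke.symm.trans h
    · rcases hT j with h' | ⟨q, d, h'⟩ <;> cases h'.symm.trans h
  have hdist : E.DistinctWrites y₂ :=
    ⟨fun o x h => (hwrite o x h).2 ▸ hv,
      fun o o' x h h' => (hwrite o x h).1.trans (hwrite o' x h').1.symm⟩
  have hcw : G.Completes w (.write v₁) (n + 0) (n + N₁) y₁ :=
    Run.append_completes_add.2
      (Run.Completes.append_left (Run.merge_completes hw h1c) N₁.lt_succ_self)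
  have hcr : G.Completes r .read (n + (N₁ + 1 + 0)) (n + (N₁ + 1 + N₂)) y₂ :=
    Run.append_completes_add.2 (Run.append_completes_add.2
      (Run.Completes.append_left (Run.merge_completes hr h2c) N₂.lt_succ_self))
  obtain ⟨-, hprop, -⟩ := hA E hfair hcard hdist
  -- Nobody writes `y₂`, so the first property would require that no write precede the read; but the
  -- write of `v₁` returns at `n + N₁`, just before the read is called.
  rcases hprop (n + (N₁ + 1 + 0)) y₂ ⟨⟨r, hcr.invoke⟩, _, r, .read, hcr.invoke, hcr.lt, hcr.returns,
    hcr.first⟩ with ⟨o, ho, -⟩ | ⟨hno, -⟩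
  · exact hv (hwrite o y₂ ho).2.symm
  · exact hno (n + 0) v₁ ⟨w, hcw.invoke⟩
      ⟨n + N₁, y₁, ⟨w, _, hcw.invoke, hcw.lt, hcw.returns, hcw.first⟩, by omega⟩

/-- Maximality of `t_L` gives two separated sets of `n - (t_L + 1)` processes. They are nonempty
because `t_L < n - 1`, and their complements have `t_L + 1 ≤ t` members. The writer can be any
member of the first set, so it depends on `L` only and not on the algorithm. -/
theorem exists_not_implements {v₀ : V} [Nontrivial V] {t : ℕ} (ht : tL L < t)
    (hn : tL L < n - 1) : ∃ w : Fin n, ∀ A : Algorithm.{u, v} L V, ¬ Implements A w v₀ t := by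
  obtain ⟨v₁, hv⟩ := exists_ne v₀
  have hnot : ¬ Overlapping L (tL L + 1) := fun h => by
    have := (isGreatest_tL (by omega) L).2 ⟨show tL L + 1 ≤ n by omega, h⟩
    omega
  simp only [Overlapping, not_forall, not_or, not_exists, not_and,
    Finset.not_nonempty_iff_eq_empty] at hnot
  obtain ⟨P, P', hP, hP', hdisj, hsep⟩ := hnot
  obtain ⟨w, hw⟩ : P.Nonempty := Finset.card_pos.1 (by omega)
  obtain ⟨r, hr⟩ : P'.Nonempty := Finset.card_pos.1 (by omega)
  refine ⟨w, fun A => not_implements_of_separated hv (Finset.disjoint_iff_inter_eq_empty.2 hdisj)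
    hsep ?_ ?_ hw hr⟩ <;> rw [Finset.card_compl, Fintype.card_fin] <;> omega

end MM

/-- In the system `S_L`: the read/write algorithm implements, for every writer `w`, an atomic SWMR register that
tolerates `t_L` crashes; and, if more than `t_L` processes may crash (where `t_L` is not already the
largest meaningful number of crashes, `n - 1`), there is a writer `w` for which no algorithm
implements such a register. -/
theorem theorem1 {n m : ℕ} (L : Fin m → Finset (Fin n)) (hL : ∀ p, ∃ i, p ∈ L i)
    {V : Type u} (v₀ : V) :
    (∀ w : Fin n, MM.Implements (MM.rwAlgorithm L v₀) w v₀ (MM.tL L)) ∧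
    (Nontrivial V → ∀ t : ℕ, MM.tL L < t → MM.tL L < n - 1 →
      ∃ w : Fin n, ∀ A : MM.Algorithm.{u, v} L V, ¬ MM.Implements A w v₀ t) := by
  refine ⟨MM.rwAlgorithm_implements hL v₀, fun _ t ht hn => MM.exists_not_implements ht hn⟩
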